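/- Fix a category $\mathbb G$. An \emph{overcategory} is a category $\mathbb E$ with a functor $\mathtt A:\mathbb E\to\mathbb G$; \emph{overfunctors} commute strictly with the functors to $\mathbb G$; a \emph{left overadjoint} is a left adjoint in the 2-category $\mathbf{CAT}/\mathbb G$, i.e. an overfunctor that is left adjoint with unit and counit components lying over identities of $\mathbb G$. An overfunctor $U$ is \emph{overmonadic} if it has a left overadjoint such that the comparison overfunctor from the domain of $U$ to the overcategory of algebras of the induced overmonad is an isomorphism of overcategories. A \emph{monoidal overcategory} $\mathcal E=(\mathbb E,\mathtt A,\otimes,I,u_l,u_r,ass)$ is a monoidal object of $\mathbf{CAT}/\mathbb G$: a functor $\otimes:\mathbb E\times_{\mathbb G}\mathbb E\to\mathbb E$ over $\mathbb G$, a section $I:\mathbb G\to\mathbb E$ of $\mathtt A$, and natural unit and associativity isomorphisms over identities of $\mathbb G$ satisfying the usual coherence axioms. Each fiber $\mathbb E_B$ is then a monoidal category. $\mathcal E$ is \emph{liberal} if, for every object $B$ of $\mathbb G$: $\mathbb E_B$ has coequalizers and colimits of sequences ($\mathbb N$-indexed colimits, $\mathbb N$ with its natural order); for every $X\in\mathbb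 E_B$ both $(-)\otimes X$ and $X\otimes(-)$ preserve colimits of sequences in $\mathbb E_B$ and $(-)\otimes X$ preserves coequalizers in $\mathbb E_B$; and the inclusion $\mathbb E_B\hookrightarrow\mathbb E$ preserves coequalizers and colimits of sequences. An \emph{overmonoid} $(C,e,m;C_0)$ is an object $C_0$ of $\mathbb G$ with a monoid $(C,e,m)$ in $\mathbb E_{C_0}$; a morphism $(C,e,m;C_0)\to(C',e',m';C_0')$ is a pair $(f,f_0)$ with $f:C\to C'$, $\mathtt A(f)=f_0$, $fm=m'(f\otimes f)$ and $fe=e'I(f_0)$. The \emph{pointed overcategory} $Pt(\mathbb E)$ has as objects the pairs $(X,x)$ with $X$ an object of $\mathbb E$ and $x:I(\mathtt A(X))\to X$ a morphism of the fiber $\mathbb E_{\mathtt A(X)}$, and as morphisms $(X,x)\to(Y,y)$ the morphisms $f:X\to Y$ of $\mathbb E$ with $fx=y\,I(\mathtt A(f))$. Both are overcategories, by $(C,e,m;C_0)\mapsto C_0$ and $(X,x)\mapsto\mathtt A(X)$. \textbf{Theorem.} If $\mathcal E$ is a liberal monoidal overcategory over $\mathbb G$, then the forgetful overfunctor from the overcategory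 of overmonoids of $\mathcal E$ to $Pt(\mathbb E)$, $(C,e,m;C_0)\mapsto(C,e)$, has a left overadjoint and is overmonadic. -/

import Mathlib

open CategoryTheory CategoryTheory.Limits MonoidalCategory

universe v₁ v₂ v₃ v₄ u₁ u₂ u₃ u₄

namespace Overcat

/-! ### Adjunctions and monadicity over a fixed base

An overcategory over `G` is a category with a functor to `G` (Mathlib's `BasedCategory G`), and an
overfunctor is a functor commuting strictly with the functors to `G` (Mathlib's `BasedFunctor`). -/

section Base

variable {G : Type u₂} [Category.{v₂} G]
  {X : BasedCategory.{v₃, u₃} G} {Y : BasedCategory.{v₄, u₄} G}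

/-- An adjunction between overfunctors in the 2-category of categories over `G`: an adjunction
whose unit and counit have all their components over identities of `G`. -/
structure Overadjunction (F : BasedFunctor X Y) (U : BasedFunctor Y X) where
  adj : F.toFunctor ⊣ U.toFunctor
  unit_over : ∀ x : X.obj, X.p.IsHomLift (𝟙 (X.p.obj x)) (adj.unit.app x)
  counit_over : ∀ y : Y.obj, Y.p.IsHomLift (𝟙 (Y.p.obj y)) (adj.counit.app y)

/-- The overfunctor `U` has a left overadjoint. -/
def HasLeftOveradjoint (U : BasedFunctor Y X) : Prop :=
  ∃ F : BasedFunctor X Y, Nonempty (Overadjunction F U)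

/-- The overcategory of algebras of the overmonad induced by an overadjunction. -/
def Overadjunction.algebras {F : BasedFunctor X Y} {U : BasedFunctor Y X}
    (h : Overadjunction F U) : BasedCategory G :=
  BasedCategory.ofFunctor (h.adj.toMonad.forget ⋙ X.p)

/-- The comparison overfunctor to the overcategory of algebras. -/
def Overadjunction.comparison {F : BasedFunctor X Y} {U : BasedFunctor Y X}
    (h : Overadjunction F U) : BasedFunctor Y h.algebras where
  toFunctor := Monad.comparison h.adj
  w := U.w

/-- An overfunctor is an isomorphism of overcategories: it has a strict two-sided inverse. -/
def IsOverisomorphism (K : BasedFunctor X Y) : Prop :=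
  ∃ L : BasedFunctor Y X,
    K.comp L = BasedFunctor.id X ∧ L.comp K = BasedFunctor.id Y

/-- The overfunctor `U` is overmonadic: it is the right member of an overadjunction whose comparison
overfunctor is an isomorphism of overcategories. -/
def IsOvermonadic (U : BasedFunctor Y X) : Prop :=
  ∃ (F : BasedFunctor X Y) (h : Overadjunction F U), IsOverisomorphism h.comparison

end Base

/-! ### Monoidal overcategories -/

section Monoidal

variable {E : Type u₁} [Category.{v₁} E] {G : Type u₂} [Category.{v₂} G]

/-- For objects `X` and `Y` of `E` over `B` and `B'`, the morphisms `X ⟶ Y` of `E` lying over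
`b : B ⟶ B'`. For `b = 𝟙 B` these are the morphisms of the fiber over `B`. -/
abbrev HomOver (A : E ⥤ G) {B B' : G} (b : B ⟶ B') (X : A.Fiber B) (Y : A.Fiber B') :
    Type v₁ :=
  {f : X.1 ⟶ Y.1 // A.IsHomLift b f}

/-- The identity of an object of a fiber. -/
def HomOver.id {A : E ⥤ G} {B : G} (X : A.Fiber B) : HomOver A (𝟙 B) X X :=
  ⟨𝟙 X.1, IsHomLift.id X.2⟩

/-- Composition of a morphism over `b` and a morphism over `b'`. -/
def HomOver.comp {A : E ⥤ G} {B B' B'' : G} {b : B ⟶ B'} {b' : B' ⟶ B''}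
    {X : A.Fiber B} {Y : A.Fiber B'} {Z : A.Fiber B''}
    (f : HomOver A b X Y) (g : HomOver A b' Y Z) : HomOver A (b ≫ b') X Z :=
  ⟨f.1 ≫ g.1, by have := f.2; have := g.2; infer_instance⟩

/-- A monoidal overcategory, i.e. a monoidal object of the 2-category of categories over `G`.

* `tensorObj`, `tensorHom` with their two laws are a functor `E ×_G E ⥤ E` over `G`: an object of
  the kernel pair `E ×_G E` is a pair of objects over one and the same `B`, and a morphism of it is
  a pair of morphisms over one and the same `b`.
* `unitObj`, `unitHom` with their two laws are a functor `G ⥤ E` that is a section of `A`.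
* The unitors and the associator are isomorphisms over identities of `G`, natural with respect to
  all morphisms of `E`, and satisfy the pentagon and triangle identities. -/
class MonoidalOvercategory (A : E ⥤ G) where
  tensorObj : ∀ {B : G}, A.Fiber B → A.Fiber B → A.Fiber B
  tensorHom : ∀ {B B' : G} {b : B ⟶ B'} {X Y : A.Fiber B} {X' Y' : A.Fiber B'},
    HomOver A b X X' → HomOver A b Y Y' → HomOver A b (tensorObj X Y) (tensorObj X' Y')
  tensorHom_id : ∀ {B : G} (X Y : A.Fiber B),
    tensorHom (HomOver.id X) (HomOver.id Y) = HomOver.id (tensorObj X Y)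
  tensorHom_comp : ∀ {B B' B'' : G} {b : B ⟶ B'} {b' : B' ⟶ B''}
    {X Y : A.Fiber B} {X' Y' : A.Fiber B'} {X'' Y'' : A.Fiber B''}
    (f : HomOver A b X X') (f' : HomOver A b' X' X'')
    (g : HomOver A b Y Y') (g' : HomOver A b' Y' Y''),
    tensorHom (f.comp f') (g.comp g') = (tensorHom f g).comp (tensorHom f' g')
  unitObj : ∀ B : G, A.Fiber B
  unitHom : ∀ {B B' : G} (b : B ⟶ B'), HomOver A b (unitObj B) (unitObj B')
  unitHom_id : ∀ B : G, unitHom (𝟙 B) = HomOver.id (unitObj B)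
  unitHom_comp : ∀ {B B' B'' : G} (b : B ⟶ B') (b' : B' ⟶ B''),
    unitHom (b ≫ b') = (unitHom b).comp (unitHom b')
  leftUnitor : ∀ {B : G} (X : A.Fiber B), tensorObj (unitObj B) X ≅ X
  rightUnitor : ∀ {B : G} (X : A.Fiber B), tensorObj X (unitObj B) ≅ X
  associator : ∀ {B : G} (X Y Z : A.Fiber B),
    tensorObj (tensorObj X Y) Z ≅ tensorObj X (tensorObj Y Z)
  leftUnitor_naturality : ∀ {B B' : G} {b : B ⟶ B'} {X : A.Fiber B} {X' : A.Fiber B'}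
    (f : HomOver A b X X'),
    (tensorHom (unitHom b) f).1 ≫ (leftUnitor X').hom.1 = (leftUnitor X).hom.1 ≫ f.1
  rightUnitor_naturality : ∀ {B B' : G} {b : B ⟶ B'} {X : A.Fiber B} {X' : A.Fiber B'}
    (f : HomOver A b X X'),
    (tensorHom f (unitHom b)).1 ≫ (rightUnitor X').hom.1 = (rightUnitor X).hom.1 ≫ f.1
  associator_naturality : ∀ {B B' : G} {b : B ⟶ B'} {X Y Z : A.Fiber B} {X' Y' Z' : A.Fiber B'}
    (f : HomOver A b X X') (g : HomOver A b Y Y') (h : HomOver A b Z Z'),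
    (tensorHom (tensorHom f g) h).1 ≫ (associator X' Y' Z').hom.1 =
      (associator X Y Z).hom.1 ≫ (tensorHom f (tensorHom g h)).1
  pentagon : ∀ {B : G} (W X Y Z : A.Fiber B),
    (tensorHom (associator W X Y).hom (HomOver.id Z)).1 ≫
        (associator W (tensorObj X Y) Z).hom.1 ≫
          (tensorHom (HomOver.id W) (associator X Y Z).hom).1 =
      (associator (tensorObj W X) Y Z).hom.1 ≫ (associator W X (tensorObj Y Z)).hom.1
  triangle : ∀ {B : G} (X Y : A.Fiber B),
    (associator X (unitObj B) Y).hom.1 ≫ (tensorHom (HomOver.id X) (leftUnitor Y).hom).1 =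
      (tensorHom (rightUnitor X).hom (HomOver.id Y)).1

namespace MonoidalOvercategory

variable {A : E ⥤ G} [MonoidalOvercategory A]

theorem tensorHom_val_congr {B B' : G} {b c : B ⟶ B'} (h : b = c)
    {X Y : A.Fiber B} {X' Y' : A.Fiber B'} (f : HomOver A b X X') (g : HomOver A b Y Y')
    (f' : HomOver A c X X') (g' : HomOver A c Y Y') (hf : f.1 = f'.1) (hg : g.1 = g'.1) :
    (tensorHom f g).1 = (tensorHom f' g').1 := by
  subst h
  rw [Subtype.ext hf, Subtype.ext hg]

variable (A) in
/-- The data of the monoidal structure of a fiber. -/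
instance fiberMonoidalStruct (B : G) : MonoidalCategoryStruct (A.Fiber B) where
  tensorObj := tensorObj
  tensorHom f g := tensorHom f g
  whiskerLeft X _ _ f := tensorHom (HomOver.id X) f
  whiskerRight f Y := tensorHom f (HomOver.id Y)
  tensorUnit := unitObj B
  leftUnitor := leftUnitor
  rightUnitor := rightUnitor
  associator := associator

variable (A) in
/-- Each fiber of a monoidal overcategory is a monoidal category. -/
instance fiberMonoidal (B : G) : MonoidalCategory (A.Fiber B) :=
  MonoidalCategory.ofTensorHom
    (id_tensorHom_id := fun X Y => tensorHom_id X Y)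
    (id_tensorHom := fun _ _ _ _ => rfl)
    (tensorHom_id := fun _ _ => rfl)
    (tensorHom_comp_tensorHom := fun f₁ f₂ g₁ g₂ => Subtype.ext <|
      (congrArg Subtype.val (tensorHom_comp (A := A) f₁ g₁ f₂ g₂)).symm.trans
        (tensorHom_val_congr (Category.id_comp (𝟙 B)) _ _ _ _ rfl rfl))
    (associator_naturality := fun f g h => Subtype.ext (associator_naturality f g h))
    (leftUnitor_naturality := fun {X Y} f => Subtype.ext <| by
      have h := leftUnitor_naturality (A := A) (b := 𝟙 B) (X := X) (X' := Y) f
      rw [unitHom_id] at h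
      exact h)
    (rightUnitor_naturality := fun {X Y} f => Subtype.ext <| by
      have h := rightUnitor_naturality (A := A) (b := 𝟙 B) (X := X) (X' := Y) f
      rw [unitHom_id] at h
      exact h)
    (pentagon := fun W X Y Z => Subtype.ext (pentagon W X Y Z))
    (triangle := fun X Y => Subtype.ext (triangle X Y))

end MonoidalOvercategory

/-! ### Liberality -/

/-- A monoidal category is liberal if it has colimits of sequences and coequalizers, tensoring on
either side preserves colimits of sequences, and `(-) ⊗ X` preserves coequalizers. -/
structure IsLiberalMonoidal (V : Type u₃) [Category.{v₃} V] [MonoidalCategory V] : Prop where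
  hasSequentialColimits : HasColimitsOfShape ℕ V
  hasCoequalizers : HasCoequalizers V
  tensorRight_sequential : ∀ X : V, PreservesColimitsOfShape ℕ (tensorRight X)
  tensorLeft_sequential : ∀ X : V, PreservesColimitsOfShape ℕ (tensorLeft X)
  tensorRight_coequalizers : ∀ X : V,
    PreservesColimitsOfShape WalkingParallelPair (tensorRight X)

/-- A monoidal overcategory is liberal if its fibers are liberal and the inclusion of each fiber
into `E` preserves coequalizers and colimits of sequences. -/
structure IsLiberal (A : E ⥤ G) [MonoidalOvercategory A] : Prop where
  fiber_liberal : ∀ B : G, IsLiberalMonoidal (A.Fiber B)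
  inclusion_coequalizers : ∀ B : G, PreservesColimitsOfShape WalkingParallelPair
    (Functor.Fiber.fiberInclusion : A.Fiber B ⥤ E)
  inclusion_sequential : ∀ B : G, PreservesColimitsOfShape ℕ
    (Functor.Fiber.fiberInclusion : A.Fiber B ⥤ E)

/-! ### Overmonoids -/

variable (A : E ⥤ G) [MonoidalOvercategory A]

/-- An overmonoid `(C, e, m; C₀)`: an object `C₀` of the base and a monoid in the fiber over it. -/
structure Overmonoid where
  base : G
  mon : Mon (A.Fiber base)

variable {A} in
/-- A morphism of overmonoids: a morphism `f₀` of the base and a morphism `f` over `f₀` with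
`f m = m' (f ⊗ f)` and `f e = e' I(f₀)`. -/
@[ext]
structure Overmonoid.Hom (C D : Overmonoid A) where
  base : C.base ⟶ D.base
  hom : HomOver A base C.mon.X D.mon.X
  mul_hom : C.mon.mon.mul.1 ≫ hom.1 =
    (MonoidalOvercategory.tensorHom hom hom).1 ≫ D.mon.mon.mul.1
  one_hom : C.mon.mon.one.1 ≫ hom.1 =
    (MonoidalOvercategory.unitHom (A := A) base).1 ≫ D.mon.mon.one.1

/-- The category of overmonoids. -/
instance : Category (Overmonoid A) where
  Hom := Overmonoid.Hom
  id C :=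
    { base := 𝟙 C.base
      hom := HomOver.id C.mon.X
      mul_hom := by
        rw [MonoidalOvercategory.tensorHom_id]
        exact (Category.comp_id _).trans (Category.id_comp _).symm
      one_hom := by
        rw [MonoidalOvercategory.unitHom_id]
        exact (Category.comp_id _).trans (Category.id_comp _).symm }
  comp f g :=
    { base := f.base ≫ g.base
      hom := f.hom.comp g.hom
      mul_hom := by
        rw [MonoidalOvercategory.tensorHom_comp]
        simp only [HomOver.comp, Category.assoc]
        rw [← g.mul_hom, ← Category.assoc, f.mul_hom, Category.assoc]
      one_hom := by
        rw [MonoidalOvercategory.unitHom_comp]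
        simp only [HomOver.comp, Category.assoc]
        rw [← g.one_hom, ← Category.assoc, f.one_hom, Category.assoc] }
  id_comp f := by
    obtain ⟨b, ⟨f, hf⟩, h₁, h₂⟩ := f
    refine Overmonoid.Hom.ext (Category.id_comp b) ?_
    refine (Subtype.heq_iff_coe_eq ?_).2 (Category.id_comp f)
    intro x
    simp
  comp_id f := by
    obtain ⟨b, ⟨f, hf⟩, h₁, h₂⟩ := f
    refine Overmonoid.Hom.ext (Category.comp_id b) ?_
    refine (Subtype.heq_iff_coe_eq ?_).2 (Category.comp_id f)
    intro x
    simp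
  assoc f g h := by
    refine Overmonoid.Hom.ext (Category.assoc _ _ _) ?_
    refine (Subtype.heq_iff_coe_eq ?_).2 (Category.assoc _ _ _)
    intro x
    simp

/-- The overcategory of overmonoids, `(C, e, m; C₀) ↦ C₀`. -/
def overmonoids : BasedCategory G where
  obj := Overmonoid A
  p :=
    { obj := fun C => C.base
      map := fun f => Overmonoid.Hom.base f }

/-! ### The pointed overcategory -/

/-- An object `(X, x)` of `Pt(E)`: an object `X` of `E`, given together with its image `base` in
`G`, and a morphism `x : I(base) ⟶ X` of the fiber over `base`. -/
structure Pointed where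
  base : G
  X : A.Fiber base
  pt : MonoidalOvercategory.unitObj base ⟶ X

variable {A} in
/-- A morphism `(X, x) ⟶ (Y, y)` of `Pt(E)`: a morphism `f : X ⟶ Y` of `E`, given together with
its image `base` in `G`, such that `f x = y I(base)`. -/
@[ext]
structure Pointed.Hom (X Y : Pointed A) where
  base : X.base ⟶ Y.base
  hom : HomOver A base X.X Y.X
  pt_hom : X.pt.1 ≫ hom.1 = (MonoidalOvercategory.unitHom (A := A) base).1 ≫ Y.pt.1

/-- The category `Pt(E)`. -/
instance : Category (Pointed A) where
  Hom := Pointed.Hom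
  id X :=
    { base := 𝟙 X.base
      hom := HomOver.id X.X
      pt_hom := by
        rw [MonoidalOvercategory.unitHom_id]
        exact (Category.comp_id _).trans (Category.id_comp _).symm }
  comp f g :=
    { base := f.base ≫ g.base
      hom := f.hom.comp g.hom
      pt_hom := by
        rw [MonoidalOvercategory.unitHom_comp]
        simp only [HomOver.comp, Category.assoc]
        rw [← g.pt_hom, ← Category.assoc, f.pt_hom, Category.assoc] }
  id_comp f := by
    obtain ⟨b, ⟨f, hf⟩, h⟩ := f
    refine Pointed.Hom.ext (Category.id_comp b) ?_
    refine (Subtype.heq_iff_coe_eq ?_).2 (Category.id_comp f)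
    intro x
    simp
  comp_id f := by
    obtain ⟨b, ⟨f, hf⟩, h⟩ := f
    refine Pointed.Hom.ext (Category.comp_id b) ?_
    refine (Subtype.heq_iff_coe_eq ?_).2 (Category.comp_id f)
    intro x
    simp
  assoc f g h := by
    refine Pointed.Hom.ext (Category.assoc _ _ _) ?_
    refine (Subtype.heq_iff_coe_eq ?_).2 (Category.assoc _ _ _)
    intro x
    simp

/-- The overcategory `Pt(E)`, `(X, x) ↦ A(X)`. -/
def pointed : BasedCategory G where
  obj := Pointed A
  p :=
    { obj := fun X => X.base
      map := fun f => Pointed.Hom.base f }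

/-- The forgetful overfunctor `(C, e, m; C₀) ↦ (C, e)` from overmonoids to pointed objects. -/
def forgetToPointed : BasedFunctor (overmonoids A) (pointed A) where
  obj (C : Overmonoid A) :=
    ({ base := C.base, X := C.mon.X, pt := C.mon.mon.one } : Pointed A)
  map {C D : Overmonoid A} (f : Overmonoid.Hom C D) :=
    ({ base := f.base, hom := f.hom, pt_hom := f.one_hom } : Pointed.Hom _ _)
  map_id _ := rfl
  map_comp _ _ := rfl
  w := rfl

end Monoidal

end Overcat

/-! The free overmonoid is built inside one fiber, and its universal property is then extended
across the base. For a pointed object `x : I ⟶ X` of a fiber, `X ⊗ -` is a pointed endofunctor. Its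
free algebra `C` on the unit is the colimit of a sequence that starts with `I` and `X ⊗ I` and
continues by coequalizers forcing the partial actions to agree. The sequence colimit carries a total
action because `X ⊗ -` preserves it; coequalizers need not be preserved on this side.

Since `- ⊗ Y` preserves both kinds of colimits, the same construction shows that `C ⊗ Y` is free on
`Y`. Extending the identity of `C` along `C ⊗ C` gives the multiplication, and the monoid laws
follow from uniqueness of extensions.

No cartesian lifts are available, so morphisms over `b : B ⟶ B'` cannot be replaced by morphisms of
a single fiber. Freeness is therefore stated for presheaves on the fiber that turn coequalizers and
sequence colimits into limits. Morphisms over `b` into a fixed object form such a presheaf because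
the fiber inclusions preserve these colimits. A pointed morphism `f` over `b` into a monoid `M` acts
on it by `q ↦ m (f ⊗ q)`, and freeness yields the unique overmonoid morphism extending `f`
(`AlgebraicallyFree.existsUnique_lift`).

For monadicity, the structure map `h` of an algebra is split by the unit `s`, and it is the split
coequalizer of two monoid morphisms. Split forks survive tensoring, so `(s ⊗ s) ≫ m ≫ h` is a
multiplication on the unchanged carrier (`tensorHom_mul_of_fork`, `monObjOfSplitEpi`). Keeping the
carrier makes the comparison bijective on objects up to equality; it is fully faithful because the
counits are split epimorphisms in the fibers (`comparison_full`). -/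

namespace Overcat

/-! ### Free algebras of pointed endofunctors -/

section FreeAlgebra

variable {V : Type u₁} [Category.{v₁} V]

/-- A presheaf on `V` sending coequalizers and colimits of sequences to limits. -/
structure ContinuousPresheaf (V : Type u₁) [Category.{v₁} V] where
  obj : V → Type v₁
  res : ∀ {Y Z : V}, (Y ⟶ Z) → obj Z → obj Y
  res_id : ∀ {Y : V} (q : obj Y), res (𝟙 Y) q = q
  res_comp : ∀ {Y Z W : V} (f : Y ⟶ Z) (g : Z ⟶ W) (q : obj W), res (f ≫ g) q = res f (res g q)
  existsUnique_coequalizer : ∀ {Y Z W : V} {f g : Y ⟶ Z} (p : Z ⟶ W) (w : f ≫ p = g ≫ p)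
    (_ : IsColimit (Cofork.ofπ p w)) (q : obj Z), res f q = res g q → ∃! r : obj W, res p r = q
  existsUnique_sequence : ∀ {D : ℕ ⥤ V} (c : Cocone D) (_ : IsColimit c) (q : ∀ n, obj (D.obj n)),
    (∀ n, res (D.map (homOfLE (Nat.le_add_right n 1))) (q (n + 1)) = q n) →
      ∃! r : obj c.pt, ∀ n, res (c.ι.app n) r = q n

/-- A pointed endofunctor. -/
structure PointedEndofunctor (V : Type u₁) [Category.{v₁} V] where
  T : V ⥤ V
  τ : ∀ X : V, X ⟶ T.obj X
  naturality : ∀ {X Y : V} (f : X ⟶ Y), f ≫ τ Y = τ X ≫ T.map f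

/-- An action of a pointed endofunctor on a continuous presheaf. If the presheaf is represented
by `Z`, this is an algebra structure on `Z`. -/
structure PresheafAction (P : PointedEndofunctor V) (Q : ContinuousPresheaf V) where
  act : ∀ {Y : V}, Q.obj Y → Q.obj (P.T.obj Y)
  act_res : ∀ {Y Z : V} (f : Y ⟶ Z) (q : Q.obj Z), act (Q.res f q) = Q.res (P.T.map f) (act q)
  act_point : ∀ {Y : V} (q : Q.obj Y), Q.res (P.τ Y) (act q) = q

/-- An algebra of a pointed endofunctor that is free on `Y`, with respect to actions of the
pointed endofunctor on continuous presheaves. -/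
structure FreeAlgebra (P : PointedEndofunctor V) (Y : V) where
  C : V
  e : Y ⟶ C
  a : P.T.obj C ⟶ C
  τ_a : P.τ C ≫ a = 𝟙 C
  existsUnique : ∀ {Q : ContinuousPresheaf V} (α : PresheafAction P Q) (q : Q.obj Y),
    ∃! h : Q.obj C, Q.res e h = q ∧ Q.res a h = α.act h

variable (P : PointedEndofunctor V)

/-- A partial action of a pointed endofunctor. -/
structure PartialAlgebra where
  dom : V
  cod : V
  s : P.T.obj dom ⟶ cod

namespace PartialAlgebra

variable {P} [HasCoequalizers V]

/-- The morphism underlying a partial action. -/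
def link (S : PartialAlgebra P) : S.dom ⟶ S.cod := P.τ S.dom ≫ S.s

/-- The universal way of extending a partial action by one step. -/
noncomputable def next (S : PartialAlgebra P) : PartialAlgebra P where
  dom := S.cod
  cod := coequalizer (S.s ≫ P.τ S.cod) (P.T.map S.link)
  s := coequalizer.π _ _

/-- The sequence of partial algebras generated by an object. -/
noncomputable def chain (P : PointedEndofunctor V) (Y : V) : ℕ → PartialAlgebra P
  -- Stage 1 is `T Y` itself: no relation is imposed before stage 2. The codomain of each partial
  -- algebra is definitionally the domain of the next.
  | 0 => ⟨Y, P.T.obj Y, 𝟙 _⟩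
  | n + 1 => (chain P Y n).next

/-- The stages of the free algebra on an object. -/
noncomputable def stage (P : PointedEndofunctor V) (Y : V) (n : ℕ) : V := (chain P Y n).dom

/-- The partial action on the stages of the free algebra. -/
noncomputable def σ (P : PointedEndofunctor V) (Y : V) (n : ℕ) :
    P.T.obj (stage P Y n) ⟶ stage P Y (n + 1) := (chain P Y n).s

/-- The transition morphisms between the stages of the free algebra. -/
noncomputable def j (P : PointedEndofunctor V) (Y : V) (n : ℕ) :
    stage P Y n ⟶ stage P Y (n + 1) := (chain P Y n).link

theorem τ_σ (Y : V) (n : ℕ) : P.τ _ ≫ σ P Y n = j P Y n := rfl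

theorem σ_j (Y : V) (n : ℕ) :
    σ P Y n ≫ j P Y (n + 1) = P.T.map (j P Y n) ≫ σ P Y (n + 1) :=
  (Category.assoc _ _ _).symm.trans
    (coequalizer.condition ((chain P Y n).s ≫ P.τ _) (P.T.map (chain P Y n).link))

theorem existsUnique_next (Q : ContinuousPresheaf V) (Y : V) (n : ℕ)
    (q : Q.obj (P.T.obj (stage P Y (n + 1))))
    (hq : Q.res (σ P Y n ≫ P.τ (stage P Y (n + 1))) q = Q.res (P.T.map (j P Y n)) q) :
    ∃! r : Q.obj (stage P Y (n + 2)), Q.res (σ P Y (n + 1)) r = q :=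
  Q.existsUnique_coequalizer _ _ (coequalizerIsCoequalizer
    ((chain P Y n).s ≫ P.τ _) (P.T.map (chain P Y n).link)) q hq

/-- The first `σ` is an identity and every later one is a coequalizer projection, which `Q` turns
into an injection. This gives uniqueness of extensions stage by stage. -/
theorem res_σ_injective (Q : ContinuousPresheaf V) (Y : V) (n : ℕ) :
    Function.Injective (Q.res (σ P Y n)) := by
  cases n with
  | zero =>
    intro r r' h
    have h' : Q.res (𝟙 _) r = Q.res (𝟙 _) r' := h
    rwa [Q.res_id, Q.res_id] at h'
  | succ n =>
    intro r r' h
    refine (existsUnique_next Q Y n (Q.res (σ P Y (n + 1)) r') ?_).unique h rfl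
    rw [← Q.res_comp, ← Q.res_comp, Category.assoc, τ_σ, σ_j]

variable {Q : ContinuousPresheaf V} (α : PresheafAction P Q)

theorem res_j_of_res_σ {Y : V} {n : ℕ} {q : Q.obj (stage P Y n)} {r : Q.obj (stage P Y (n + 1))}
    (h : Q.res (σ P Y n) r = α.act q) : Q.res (j P Y n) r = q := by
  rw [← τ_σ, Q.res_comp, h, α.act_point]

/-- Both restrictions of `α.act r` along the coequalized pair reduce to `α.act q`: one by the point
law, the other by naturality of the action. -/
theorem exists_extension (Y : V) (n : ℕ) (q : Q.obj (stage P Y n)) (r : Q.obj (stage P Y (n + 1)))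
    (h : Q.res (σ P Y n) r = α.act q) :
    ∃ s : Q.obj (stage P Y (n + 2)), Q.res (σ P Y (n + 1)) s = α.act r := by
  refine (existsUnique_next Q Y n (α.act r) ?_).exists
  rw [Q.res_comp, α.act_point, ← α.act_res, res_j_of_res_σ α h, h]

theorem exists_family (Y : V) (q : Q.obj Y) :
    ∃ r : ∀ n, Q.obj (stage P Y n), r 0 = q ∧
      ∀ n, Q.res (σ P Y n) (r (n + 1)) = α.act (r n) := by
  classical
  choose s hs using exists_extension α Y
  -- The recursion carries two consecutive elements together with their compatibility, since
  -- extending one step needs all three.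
  let F : ∀ n, {p : Q.obj (stage P Y n) × Q.obj (stage P Y (n + 1)) //
      Q.res (σ P Y n) p.2 = α.act p.1} := fun n => Nat.rec
    ⟨(q, α.act q), Q.res_id _⟩
    (fun n p => ⟨(p.1.2, s n p.1.1 p.1.2 p.2), hs n p.1.1 p.1.2 p.2⟩) n
  exact ⟨fun n => (F n).1.1, rfl, fun n => (F n).2⟩

/-- The stages of the free algebra, as a functor. -/
noncomputable def stages (P : PointedEndofunctor V) (Y : V) : ℕ ⥤ V := Functor.ofSequence (j P Y)

theorem stages_map_succ (Y : V) (n : ℕ) :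
    (stages P Y).map (homOfLE (Nat.le_add_right n 1)) = j P Y n :=
  Functor.ofSequence_map_homOfLE_succ (j P Y) n

variable [HasColimitsOfShape ℕ V]

/-- The inclusions of the stages into the free algebra. -/
noncomputable def incl (P : PointedEndofunctor V) (Y : V) (n : ℕ) :
    stage P Y n ⟶ colimit (stages P Y) := colimit.ι (stages P Y) n

theorem j_incl (Y : V) (n : ℕ) : j P Y n ≫ incl P Y (n + 1) = incl P Y n := by
  rw [← stages_map_succ]
  exact colimit.w (stages P Y) _

/-- The cocone over the image of the stages that is induced by the partial actions. -/
noncomputable def actionCocone (P : PointedEndofunctor V) (Y : V) : Cocone (stages P Y ⋙ P.T) where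
  pt := colimit (stages P Y)
  ι := NatTrans.ofSequence (fun n => σ P Y n ≫ incl P Y (n + 1)) (fun n => by
    refine (congrArg (fun f => P.T.map f ≫ _) (stages_map_succ Y n)).trans
      (Eq.trans ?_ (Category.comp_id _).symm)
    change P.T.map (j P Y n) ≫ σ P Y (n + 1) ≫ incl P Y (n + 2) = σ P Y n ≫ incl P Y (n + 1)
    rw [← Category.assoc, ← σ_j, Category.assoc, j_incl])

variable [PreservesColimitsOfShape ℕ P.T]

/-- The action on the free algebra. -/
noncomputable def action (P : PointedEndofunctor V) (Y : V) [PreservesColimitsOfShape ℕ P.T] :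
    P.T.obj (colimit (stages P Y)) ⟶ colimit (stages P Y) :=
  (isColimitOfPreserves P.T (colimit.isColimit (stages P Y))).desc (actionCocone P Y)

theorem map_incl_action (Y : V) (n : ℕ) :
    P.T.map (incl P Y n) ≫ action P Y = σ P Y n ≫ incl P Y (n + 1) :=
  (isColimitOfPreserves P.T (colimit.isColimit (stages P Y))).fac (actionCocone P Y) n

theorem point_action (Y : V) : P.τ _ ≫ action P Y = 𝟙 (colimit (stages P Y)) := by
  refine colimit.hom_ext fun n => ?_
  change incl P Y n ≫ P.τ _ ≫ action P Y = incl P Y n ≫ 𝟙 _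
  rw [← Category.assoc, P.naturality, Category.assoc, map_incl_action, ← Category.assoc,
    τ_σ, j_incl, Category.comp_id]

theorem action_existsUnique (Y : V) (q : Q.obj Y) :
    ∃! h : Q.obj (colimit (stages P Y)),
      Q.res (incl P Y 0) h = q ∧ Q.res (action P Y) h = α.act h := by
  obtain ⟨r, hr₀, hr⟩ := exists_family α Y q
  have key := Q.existsUnique_sequence (colimit.cocone (stages P Y)) (colimit.isColimit _) r
    (fun n => by
      rw [stages_map_succ]
      exact res_j_of_res_σ α (hr n))
  obtain ⟨h, hh, hu⟩ := key
  have hh' : ∀ n, Q.res (incl P Y n) h = r n := hh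
  refine ⟨h, ⟨(hh' 0).trans hr₀, ?_⟩, ?_⟩
  -- `T` preserves the colimit of the stages, so the two elements over `T C` may be compared on each
  -- `T (stage n)`.
  · refine (Q.existsUnique_sequence _ (isColimitOfPreserves P.T (colimit.isColimit (stages P Y)))
      (fun n => α.act (r n)) (fun n => ?_)).unique (fun n => ?_) (fun n => ?_)
    · refine (congrArg (fun f => Q.res (P.T.map f) _) (stages_map_succ Y n)).trans ?_
      exact (α.act_res _ _).symm.trans (congrArg _ (res_j_of_res_σ α (hr n)))
    · change Q.res (P.T.map (incl P Y n)) (Q.res (action P Y) h) = _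
      rw [← Q.res_comp, map_incl_action, Q.res_comp, hh', hr]
      rfl
    · change Q.res (P.T.map (incl P Y n)) (α.act h) = _
      rw [← α.act_res, hh']
      rfl
  · rintro h' ⟨h₀, h₁⟩
    refine hu h' fun n => ?_
    change Q.res (incl P Y n) h' = r n
    induction n with
    | zero => exact h₀.trans hr₀.symm
    | succ n ih =>
      -- Compatibility with the action fixes the restriction to stage `n + 1` once it is pulled back
      -- along `σ`.
      apply res_σ_injective
      rw [hr, ← Q.res_comp, ← map_incl_action, Q.res_comp, h₁, ← α.act_res, ih]

end PartialAlgebra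

/-- The free algebra of a pointed endofunctor that preserves colimits of sequences. -/
noncomputable def freeAlgebra [HasCoequalizers V] [HasColimitsOfShape ℕ V]
    [PreservesColimitsOfShape ℕ P.T] (Y : V) : FreeAlgebra P Y where
  C := colimit (PartialAlgebra.stages P Y)
  e := PartialAlgebra.incl P Y 0
  a := PartialAlgebra.action P Y
  τ_a := PartialAlgebra.point_action Y
  existsUnique α q := PartialAlgebra.action_existsUnique α Y q

end FreeAlgebra

theorem existsUnique_desc_sequence {V : Type u₁} [Category.{v₁} V] {D : ℕ ⥤ V} {c : Cocone D}
    (hc : IsColimit c) {Z : V} (q : ∀ n, D.obj n ⟶ Z)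
    (hq : ∀ n, D.map (homOfLE (Nat.le_add_right n 1)) ≫ q (n + 1) = q n) :
    ∃! r : c.pt ⟶ Z, ∀ n, c.ι.app n ≫ r = q n := by
  let s : Cocone D := ⟨Z, NatTrans.ofSequence q fun n =>
    (hq n).trans (Category.comp_id (q n)).symm⟩
  exact ⟨hc.desc s, fun n => hc.fac s n, fun r hr => hc.uniq s r hr⟩

theorem existsUnique_desc_coequalizer {V : Type u₁} [Category.{v₁} V] {Y Z W : V} {f g : Y ⟶ Z}
    {p : Z ⟶ W} {w : f ≫ p = g ≫ p} (hp : IsColimit (Cofork.ofπ p w)) {U : V} (q : Z ⟶ U)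
    (hq : f ≫ q = g ≫ q) : ∃! r : W ⟶ U, p ≫ r = q :=
  Cofork.IsColimit.existsUnique hp q hq

/-! ### Free monoids on pointed objects -/

section FreeMonoid

variable {V : Type u₁} [Category.{v₁} V]

/-- The presheaf represented by an object. -/
def ContinuousPresheaf.representable (Z : V) : ContinuousPresheaf V where
  obj Y := Y ⟶ Z
  res f q := f ≫ q
  res_id q := Category.id_comp q
  res_comp f g q := Category.assoc f g q
  existsUnique_coequalizer _ _ hp q hq := existsUnique_desc_coequalizer hp q hq
  existsUnique_sequence _ hc q hq := existsUnique_desc_sequence hc q hq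

variable [MonoidalCategory V]

/-- The presheaf `W ↦ Q (W ⊗ Y)`. -/
def ContinuousPresheaf.shift (hV : IsLiberalMonoidal V) (Q : ContinuousPresheaf V) (Y : V) :
    ContinuousPresheaf V where
  obj W := Q.obj (W ⊗ Y)
  res f q := Q.res (f ▷ Y) q
  res_id q := by rw [id_whiskerRight, Q.res_id]
  res_comp f g q := by rw [comp_whiskerRight, Q.res_comp]
  existsUnique_coequalizer p w hp q hq :=
    haveI := hV.tensorRight_coequalizers Y
    Q.existsUnique_coequalizer (p ▷ Y) _ (isColimitCoforkMapOfIsColimit (tensorRight Y) w hp) q hq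
  existsUnique_sequence _ hc q hq :=
    haveI := hV.tensorRight_sequential Y
    Q.existsUnique_sequence _ (isColimitOfPreserves (tensorRight Y) hc) q hq

/-- The pointed endofunctor `X ⊗ -` of a pointed object `X`. -/
@[simps]
def tensorPoint {X : V} (x : 𝟙_ V ⟶ X) : PointedEndofunctor V where
  T := tensorLeft X
  τ Y := (λ_ Y).inv ≫ x ▷ Y
  naturality f := by
    rw [Category.assoc]
    exact (leftUnitor_inv_naturality_assoc f _).trans (congrArg _ (whisker_exchange x f))

/-- An action of a pointed object on a presheaf. If the presheaf is represented by `Z`, this is an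
action on `Z`. -/
structure PointAction {X : V} (x : 𝟙_ V ⟶ X) (Q : ContinuousPresheaf V) where
  act : ∀ {Y : V}, Q.obj Y → Q.obj (X ⊗ Y)
  act_res : ∀ {Y Z : V} (f : Y ⟶ Z) (q : Q.obj Z), act (Q.res f q) = Q.res (X ◁ f) (act q)
  act_point : ∀ {Y : V} (q : Q.obj Y), Q.res (x ▷ Y) (act q) = Q.res (λ_ Y).hom q

/-- The action on a presheaf represented by an object with an action. -/
@[simps]
def PointAction.representable {X : V} (x : 𝟙_ V ⟶ X) {Z : V} (z : X ⊗ Z ⟶ Z)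
    (h : x ▷ Z ≫ z = (λ_ Z).hom) : PointAction x (ContinuousPresheaf.representable Z) where
  act q := X ◁ q ≫ z
  act_res {Y Y'} f (q : Y' ⟶ Z) := by
    change X ◁ (f ≫ q) ≫ z = X ◁ f ≫ X ◁ q ≫ z
    rw [whiskerLeft_comp, Category.assoc]
  act_point {Y} (q : Y ⟶ Z) := by
    change x ▷ Y ≫ X ◁ q ≫ z = (λ_ Y).hom ≫ q
    rw [← whisker_exchange_assoc, h, leftUnitor_naturality]

/-- The action on a shifted presheaf. -/
def PointAction.shift (hV : IsLiberalMonoidal V) {X : V} {x : 𝟙_ V ⟶ X} {Q : ContinuousPresheaf V}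
    (α : PointAction x Q) (Y : V) : PresheafAction (tensorPoint x) (Q.shift hV Y) where
  act {W} q := Q.res (α_ X W Y).hom (α.act q)
  act_res {W W'} f (q : Q.obj (W' ⊗ Y)) := by
    change Q.res _ (α.act (Q.res (f ▷ Y) q)) = Q.res ((X ◁ f) ▷ Y) (Q.res _ (α.act q))
    rw [α.act_res, ← Q.res_comp, ← Q.res_comp, ← associator_naturality_middle]
  act_point {W} (q : Q.obj (W ⊗ Y)) := by
    change Q.res (((λ_ W).inv ≫ x ▷ W) ▷ Y) (Q.res (α_ X W Y).hom (α.act q)) = q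
    rw [comp_whiskerRight, Q.res_comp, ← Q.res_comp (x ▷ W ▷ Y), associator_naturality_left,
      Q.res_comp, α.act_point, ← Q.res_comp, ← Q.res_comp]
    refine Eq.trans ?_ (Q.res_id q)
    congr 1
    simp

/-- An object `C` with an action of a pointed object such that each `C ⊗ Y` is free on `Y` with
respect to actions on presheaves. -/
structure AlgebraicallyFree {X : V} (x : 𝟙_ V ⟶ X) where
  C : V
  e : 𝟙_ V ⟶ C
  a : X ⊗ C ⟶ C
  x_a : x ▷ C ≫ a = (λ_ C).hom
  existsUnique : ∀ {Q : ContinuousPresheaf V} (α : PointAction x Q) (Y : V) (q : Q.obj Y),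
    ∃! h : Q.obj (C ⊗ Y), Q.res (e ▷ Y) h = Q.res (λ_ Y).hom q ∧
      Q.res (a ▷ Y) h = Q.res (α_ X C Y).hom (α.act h)

/-- In a liberal monoidal category the free algebra on the unit is algebraically free. -/
noncomputable def algebraicallyFree (hV : IsLiberalMonoidal V) {X : V} (x : 𝟙_ V ⟶ X) :
    AlgebraicallyFree x :=
  haveI := hV.hasCoequalizers
  haveI := hV.hasSequentialColimits
  haveI : PreservesColimitsOfShape ℕ (tensorPoint x).T := hV.tensorLeft_sequential X
  let F := freeAlgebra (tensorPoint x) (𝟙_ V)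
  { C := F.C
    e := F.e
    a := F.a
    x_a := by
      have h : (λ_ F.C).inv ≫ x ▷ F.C ≫ F.a = 𝟙 F.C := (Category.assoc _ _ _).symm.trans F.τ_a
      exact ((Iso.inv_comp_eq _).1 h).trans (Category.comp_id _)
    existsUnique := fun {Q} α Y q =>
      F.existsUnique (α.shift hV Y) (Q.res (λ_ Y).hom q) }

/-! ### The monoid structure on the algebraically free object -/

namespace AlgebraicallyFree

variable {X : V} {x : 𝟙_ V ⟶ X} (F : AlgebraicallyFree x)

theorem hom_ext {Q : ContinuousPresheaf V} (α : PointAction x Q) {Y : V} {h h' : Q.obj (F.C ⊗ Y)}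
    (he : Q.res (F.e ▷ Y) h = Q.res (F.e ▷ Y) h')
    (ha : Q.res (F.a ▷ Y) h = Q.res (α_ X F.C Y).hom (α.act h))
    (ha' : Q.res (F.a ▷ Y) h' = Q.res (α_ X F.C Y).hom (α.act h')) : h = h' := by
  refine (F.existsUnique α Y (Q.res (λ_ Y).inv (Q.res (F.e ▷ Y) h'))).unique ⟨?_, ha⟩ ⟨?_, ha'⟩
  · rw [← Q.res_comp (λ_ Y).hom, Iso.hom_inv_id, Q.res_id, he]
  · rw [← Q.res_comp (λ_ Y).hom, Iso.hom_inv_id, Q.res_id]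

/-- The action of the pointed object on the algebraically free object. -/
def action : PointAction x (ContinuousPresheaf.representable F.C) :=
  PointAction.representable x F.a F.x_a

theorem hom_ext_representable {Y : V} {h h' : F.C ⊗ Y ⟶ F.C} (he : F.e ▷ Y ≫ h = F.e ▷ Y ≫ h')
    (ha : F.a ▷ Y ≫ h = (α_ X F.C Y).hom ≫ X ◁ h ≫ F.a)
    (ha' : F.a ▷ Y ≫ h' = (α_ X F.C Y).hom ≫ X ◁ h' ≫ F.a) : h = h' :=
  F.hom_ext F.action he ha ha'

theorem exists_mul : ∃ m : F.C ⊗ F.C ⟶ F.C, F.e ▷ F.C ≫ m = (λ_ F.C).hom ∧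
    F.a ▷ F.C ≫ m = (α_ X F.C F.C).hom ≫ X ◁ m ≫ F.a := by
  obtain ⟨m, ⟨h, h'⟩, -⟩ := F.existsUnique F.action F.C (𝟙 F.C)
  exact ⟨m, h.trans (Category.comp_id _), h'⟩

/-- The multiplication of the free monoid. -/
noncomputable def mul : F.C ⊗ F.C ⟶ F.C := F.exists_mul.choose

theorem e_mul : F.e ▷ F.C ≫ F.mul = (λ_ F.C).hom := F.exists_mul.choose_spec.1

theorem a_mul : F.a ▷ F.C ≫ F.mul = (α_ X F.C F.C).hom ≫ X ◁ F.mul ≫ F.a :=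
  F.exists_mul.choose_spec.2

/-- Both sides agree after restriction along `e` and commute with the action of `X`, so freeness of
`C ⊗ 𝟙_` identifies them. -/
theorem mul_e : F.C ◁ F.e ≫ F.mul = (ρ_ F.C).hom := by
  apply F.hom_ext_representable
  · rw [← whisker_exchange_assoc, e_mul, leftUnitor_naturality, rightUnitor_naturality,
      unitors_equal]
  · rw [← whisker_exchange_assoc, a_mul]
    simp
  · rw [rightUnitor_naturality]
    simp

theorem mul_assoc : F.mul ▷ F.C ≫ F.mul = (α_ F.C F.C F.C).hom ≫ F.C ◁ F.mul ≫ F.mul := by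
  -- Reassociating gives the domain the form `C ⊗ Y` with `Y = C ⊗ C`, to which freeness applies.
  rw [← Iso.inv_comp_eq]
  apply F.hom_ext_representable
  · rw [associator_inv_naturality_left_assoc, ← comp_whiskerRight_assoc, e_mul,
      ← whisker_exchange_assoc, e_mul]
    simp
  · rw [associator_inv_naturality_left_assoc, ← comp_whiskerRight_assoc, a_mul]
    simp only [comp_whiskerRight, Category.assoc, a_mul]
    simp
  · rw [← whisker_exchange_assoc, a_mul]
    simp

/-- The free monoid on a pointed object. -/
@[simps]
noncomputable def mon : Mon V where
  X := F.C
  mon :=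
    { one := F.e
      mul := F.mul
      one_mul := F.e_mul
      mul_one := F.mul_e
      mul_assoc := F.mul_assoc }

/-- The inclusion of the generating pointed object. -/
def η : X ⟶ F.C := (ρ_ X).inv ≫ X ◁ F.e ≫ F.a

theorem x_η : x ≫ F.η = F.e := by
  rw [η, ← Category.assoc, rightUnitor_inv_naturality, Category.assoc, ← whisker_exchange_assoc,
    F.x_a, leftUnitor_naturality, unitors_equal, Iso.inv_hom_id_assoc]

/-- The action is left multiplication by generators. This lets the universal property for actions be
read as one for monoids. -/
theorem η_mul : F.η ▷ F.C ≫ F.mul = F.a := by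
  have h : (X ◁ F.e) ▷ F.C ≫ (α_ X F.C F.C).hom ≫ X ◁ F.mul =
      (α_ X (𝟙_ V) F.C).hom ≫ X ◁ (λ_ F.C).hom := by
    rw [associator_naturality_middle_assoc, ← whiskerLeft_comp, e_mul]
  rw [η, comp_whiskerRight, comp_whiskerRight, Category.assoc, Category.assoc, a_mul,
    reassoc_of% h, triangle_assoc, ← comp_whiskerRight_assoc, Iso.inv_hom_id, id_whiskerRight,
    Category.id_comp]

end AlgebraicallyFree

end FreeMonoid

/-! ### Morphisms over a morphism of the base -/

section HomOver

variable {E : Type u₁} [Category.{v₁} E] {G : Type u₂} [Category.{v₂} G] {A : E ⥤ G}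

/-- The image of `p` in the base is an `eqToHom`, hence can be cancelled. Morphisms induced on a
colimit in a fiber are thereby seen to lie over `b`. -/
theorem isHomLift_of_comp {B B' : G} (b : B ⟶ B') {X Y Z : E} (p : X ⟶ Y) (r : Y ⟶ Z)
    [A.IsHomLift (𝟙 B) p] [A.IsHomLift b (p ≫ r)] : A.IsHomLift b r := by
  have hX := IsHomLift.domain_eq A (𝟙 B) p
  have hY := IsHomLift.codomain_eq A (𝟙 B) p
  have hZ := IsHomLift.codomain_eq A b (p ≫ r)
  refine IsHomLift.of_fac' A b r hY hZ ?_
  have h := IsHomLift.fac' A b (p ≫ r)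
  rw [A.map_comp, IsHomLift.fac' A (𝟙 B) p] at h
  have h' : eqToHom (hX.trans hY.symm) ≫ A.map r =
      eqToHom (hX.trans hY.symm) ≫ eqToHom hY ≫ b ≫ eqToHom hZ.symm := by
    simpa using h
  exact (cancel_epi _).1 h'

theorem base_eq_of_isHomLift {B B' : G} {b c : B ⟶ B'} {X Y : E} (f : X ⟶ Y)
    (hb : A.IsHomLift b f) (hc : A.IsHomLift c f) : b = c := by
  rw [IsHomLift.fac A b f, IsHomLift.fac A c f]

namespace HomOver

variable {B B' : G} {b : B ⟶ B'}

/-- Precomposition with a morphism of the fiber. -/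
def pre {X Y : A.Fiber B} {Z : A.Fiber B'} (u : X ⟶ Y) (q : HomOver A b Y Z) : HomOver A b X Z :=
  ⟨u.1 ≫ q.1, by have := u.2; have := q.2; infer_instance⟩

/-- Postcomposition with a morphism of the fiber. -/
def post {X : A.Fiber B} {Y Z : A.Fiber B'} (q : HomOver A b X Y) (u : Y ⟶ Z) : HomOver A b X Z :=
  ⟨q.1 ≫ u.1, by have := u.2; have := q.2; infer_instance⟩

theorem pre_id {X : A.Fiber B} {Z : A.Fiber B'} (q : HomOver A b X Z) : pre (𝟙 X) q = q :=
  Subtype.ext (Category.id_comp q.1)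

theorem pre_comp {X Y W : A.Fiber B} {Z : A.Fiber B'} (u : X ⟶ Y) (v : Y ⟶ W)
    (q : HomOver A b W Z) : pre (u ≫ v) q = pre u (pre v q) :=
  Subtype.ext (Category.assoc u.1 v.1 q.1)

theorem post_comp {X : A.Fiber B} {Y Z W : A.Fiber B'} (q : HomOver A b X Y) (u : Y ⟶ Z)
    (v : Z ⟶ W) : post q (u ≫ v) = post (post q u) v :=
  Subtype.ext (Category.assoc q.1 u.1 v.1).symm

theorem post_id {X : A.Fiber B} {Z : A.Fiber B'} (q : HomOver A b X Z) : post q (𝟙 Z) = q :=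
  Subtype.ext (Category.comp_id q.1)

theorem pre_post {X Y : A.Fiber B} {Z W : A.Fiber B'} (u : X ⟶ Y) (q : HomOver A b Y Z)
    (v : Z ⟶ W) : pre u (post q v) = post (pre u q) v :=
  Subtype.ext (Category.assoc u.1 q.1 v.1).symm

variable (b) in
/-- The presheaf of morphisms over `b` into an object. -/
def presheaf [MonoidalOvercategory A] (hA : IsLiberal A) (Z : A.Fiber B') :
    ContinuousPresheaf (A.Fiber B) where
  obj Y := HomOver A b Y Z
  res := pre
  res_id := pre_id
  res_comp := pre_comp
  existsUnique_coequalizer {X Y W f g} p w hp q hq := by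
    have := hA.inclusion_coequalizers B
    obtain ⟨r, hr, hu⟩ := existsUnique_desc_coequalizer
      (isColimitCoforkMapOfIsColimit Functor.Fiber.fiberInclusion w hp) q.1
      (congrArg Subtype.val hq)
    have hr' : p.1 ≫ r = q.1 := hr
    have := p.2
    have : A.IsHomLift b (p.1 ≫ r) := hr' ▸ q.2
    exact ⟨⟨r, isHomLift_of_comp b p.1 r⟩, Subtype.ext hr,
      fun s hs => Subtype.ext (hu s.1 (congrArg Subtype.val hs))⟩
  existsUnique_sequence {D} c hc q hq := by
    have := hA.inclusion_sequential B
    obtain ⟨r, hr, hu⟩ := existsUnique_desc_sequence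
      (isColimitOfPreserves Functor.Fiber.fiberInclusion hc) (fun n => (q n).1)
      (fun n => congrArg Subtype.val (hq n))
    -- A single leg over an identity suffices to locate `r` over `b`; leg `0` is chosen.
    have hr' : (c.ι.app 0).1 ≫ r = (q 0).1 := hr 0
    have := (c.ι.app 0).2
    have : A.IsHomLift b ((c.ι.app 0).1 ≫ r) := hr' ▸ (q 0).2
    exact ⟨⟨r, isHomLift_of_comp b (c.ι.app 0).1 r⟩, fun n => Subtype.ext (hr n),
      fun s hs => Subtype.ext (hu s.1 fun n => congrArg Subtype.val (hs n))⟩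

variable [MonoidalOvercategory A]

/-- The tensor product of morphisms over `b`. -/
def tensor {X Y : A.Fiber B} {X' Y' : A.Fiber B'} (f : HomOver A b X X') (g : HomOver A b Y Y') :
    HomOver A b (X ⊗ Y) (X' ⊗ Y') :=
  MonoidalOvercategory.tensorHom f g

variable (A b) in
/-- The morphism over `b` between the units. -/
def unit : HomOver A b (𝟙_ (A.Fiber B)) (𝟙_ (A.Fiber B')) :=
  MonoidalOvercategory.unitHom b

/-- This is functoriality of the tensor product, stated so that the base stays `b` instead of `𝟙 B ≫
b`; the two are only propositionally equal. -/
theorem pre_tensorHom {X Y X₁ Y₁ : A.Fiber B} {X' Y' : A.Fiber B'} (u : X₁ ⟶ X) (v : Y₁ ⟶ Y)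
    (f : HomOver A b X X') (g : HomOver A b Y Y') :
    pre (u ⊗ₘ v) (tensor f g) = tensor (pre u f) (pre v g) :=
  Subtype.ext <| (congrArg Subtype.val
    (MonoidalOvercategory.tensorHom_comp (A := A) (b := 𝟙 B) u f v g)).symm.trans
      (MonoidalOvercategory.tensorHom_val_congr (Category.id_comp b) _ _ _ _ rfl rfl)

theorem post_tensorHom {X Y : A.Fiber B} {X' Y' X₁ Y₁ : A.Fiber B'} (u : X' ⟶ X₁) (v : Y' ⟶ Y₁)
    (f : HomOver A b X X') (g : HomOver A b Y Y') :
    post (tensor f g) (u ⊗ₘ v) = tensor (post f u) (post g v) :=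
  Subtype.ext <| (congrArg Subtype.val
    (MonoidalOvercategory.tensorHom_comp (A := A) (b' := 𝟙 B') f u g v)).symm.trans
      (MonoidalOvercategory.tensorHom_val_congr (Category.comp_id b) _ _ _ _ rfl rfl)

theorem pre_whiskerLeft {X Y Y₁ : A.Fiber B} {X' Y' : A.Fiber B'} (v : Y₁ ⟶ Y)
    (f : HomOver A b X X') (g : HomOver A b Y Y') :
    pre (X ◁ v) (tensor f g) = tensor f (pre v g) := by
  rw [← id_tensorHom, pre_tensorHom, pre_id]

theorem pre_whiskerRight {X Y X₁ : A.Fiber B} {X' Y' : A.Fiber B'} (u : X₁ ⟶ X)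
    (f : HomOver A b X X') (g : HomOver A b Y Y') :
    pre (u ▷ Y) (tensor f g) = tensor (pre u f) g := by
  rw [← tensorHom_id, pre_tensorHom, pre_id]

theorem post_whiskerLeft {X Y : A.Fiber B} {X' Y' Y₁ : A.Fiber B'} (v : Y' ⟶ Y₁)
    (f : HomOver A b X X') (g : HomOver A b Y Y') :
    post (tensor f g) (X' ◁ v) = tensor f (post g v) := by
  rw [← id_tensorHom, post_tensorHom, post_id]

theorem post_whiskerRight {X Y : A.Fiber B} {X' Y' X₁ : A.Fiber B'} (u : X' ⟶ X₁)
    (f : HomOver A b X X') (g : HomOver A b Y Y') :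
    post (tensor f g) (u ▷ Y') = tensor (post f u) g := by
  rw [← tensorHom_id, post_tensorHom, post_id]

theorem post_leftUnitor {X : A.Fiber B} {X' : A.Fiber B'} (f : HomOver A b X X') :
    post (tensor (unit A b) f) (λ_ X').hom = pre (λ_ X).hom f :=
  Subtype.ext (MonoidalOvercategory.leftUnitor_naturality f)

theorem post_rightUnitor {X : A.Fiber B} {X' : A.Fiber B'} (f : HomOver A b X X') :
    post (tensor f (unit A b)) (ρ_ X').hom = pre (ρ_ X).hom f :=
  Subtype.ext (MonoidalOvercategory.rightUnitor_naturality f)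

theorem post_associator {X Y Z : A.Fiber B} {X' Y' Z' : A.Fiber B'} (f : HomOver A b X X')
    (g : HomOver A b Y Y') (h : HomOver A b Z Z') :
    post (tensor (tensor f g) h) (α_ X' Y' Z').hom =
      pre (α_ X Y Z).hom (tensor f (tensor g h)) :=
  Subtype.ext (MonoidalOvercategory.associator_naturality f g h)

/-- A morphism over `b` between pointed objects that is compatible with the points. -/
def IsPointed {X : A.Fiber B} (x : 𝟙_ (A.Fiber B) ⟶ X) {Y : A.Fiber B'} (y : 𝟙_ (A.Fiber B') ⟶ Y)
    (f : HomOver A b X Y) : Prop :=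
  pre x f = post (unit A b) y

/-- A morphism over `b` between objects with multiplications
that is compatible with the multiplications. -/
def IsMultiplicative {X : A.Fiber B} (m : X ⊗ X ⟶ X) {Y : A.Fiber B'} (n : Y ⊗ Y ⟶ Y)
    (f : HomOver A b X Y) : Prop :=
  pre m f = post (tensor f f) n

/-- The action on morphisms into a monoid over `b` that is induced by a pointed morphism. -/
def pointAction (hA : IsLiberal A) {X : A.Fiber B} {x : 𝟙_ (A.Fiber B) ⟶ X}
    (M : Mon (A.Fiber B')) (f : HomOver A b X M.X) (hf : IsPointed x M.mon.one f) :
    PointAction x (presheaf b hA M.X) where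
  act q := post (tensor f q) M.mon.mul
  act_res {Y Z} u (q : HomOver A b Z M.X) := by
    change post (tensor f (pre u q)) _ = pre (X ◁ u) (post (tensor f q) M.mon.mul)
    rw [pre_post, pre_whiskerLeft]
  act_point {Y} (q : HomOver A b Y M.X) := by
    change pre (x ▷ Y) (post (tensor f q) M.mon.mul) = pre (λ_ Y).hom q
    rw [pre_post, pre_whiskerRight, hf, ← post_whiskerRight, ← post_comp, M.mon.one_mul,
      post_leftUnitor]

end HomOver

/-! ### The universal property of the free monoid across the base -/

namespace AlgebraicallyFree

open HomOver

variable [MonoidalOvercategory A] {B B' : G} {b : B ⟶ B'} {X : A.Fiber B}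
  {x : 𝟙_ (A.Fiber B) ⟶ X} (F : AlgebraicallyFree x) {M : Mon (A.Fiber B')}

theorem pre_a_of_isMultiplicative {g : HomOver A b F.C M.X}
    (hg : IsMultiplicative F.mul M.mon.mul g) :
    pre F.a g = post (tensor (pre F.η g) g) M.mon.mul := by
  rw [← F.η_mul, pre_comp, hg, pre_post, pre_whiskerRight]

theorem pre_η {f : HomOver A b X M.X} {h : HomOver A b F.C M.X}
    (he : pre F.e h = post (unit A b) M.mon.one) (ha : pre F.a h = post (tensor f h) M.mon.mul) :
    pre F.η h = f := by
  rw [η, pre_comp, pre_comp, ha, pre_post, pre_whiskerLeft, he, ← post_whiskerLeft, ← post_comp,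
    M.mon.mul_one, post_rightUnitor, ← pre_comp, Iso.inv_hom_id, pre_id]

variable (hA : IsLiberal A)
include hA

/-- Over `b`, a morphism out of `C ⊗ Y` is determined by its restriction to `Y` if it is compatible
with the actions. -/
theorem homOver_ext {f : HomOver A b X M.X} (hf : IsPointed x M.mon.one f) {Y : A.Fiber B}
    {g h : HomOver A b (F.C ⊗ Y) M.X} (he : pre (F.e ▷ Y) g = pre (F.e ▷ Y) h)
    (hg : pre (F.a ▷ Y) g = pre (α_ X F.C Y).hom (post (tensor f g) M.mon.mul))
    (hh : pre (F.a ▷ Y) h = pre (α_ X F.C Y).hom (post (tensor f h) M.mon.mul)) : g = h :=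
  F.hom_ext (pointAction hA M f hf) he hg hh

/-- Freeness speaks of `C ⊗ Y`; taking `Y = 𝟙_` and transporting along the right unitor gives the
statement for `C`. -/
theorem exists_lift {f : HomOver A b X M.X} (hf : IsPointed x M.mon.one f) :
    ∃ h : HomOver A b F.C M.X, pre F.e h = post (unit A b) M.mon.one ∧
      pre F.a h = post (tensor f h) M.mon.mul := by
  obtain ⟨k, ⟨hk, hk'⟩, -⟩ := F.existsUnique (pointAction hA M f hf) (𝟙_ _)
    (post (unit A b) M.mon.one)
  change HomOver A b _ _ at k
  replace hk : pre (F.e ▷ 𝟙_ _) k = pre (λ_ (𝟙_ _)).hom (post (unit A b) M.mon.one) := hk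
  replace hk' : pre (F.a ▷ 𝟙_ _) k = pre (α_ X F.C (𝟙_ _)).hom (post (tensor f k) M.mon.mul) := hk'
  refine ⟨pre (ρ_ F.C).inv k, ?_, ?_⟩
  · rw [← pre_comp, rightUnitor_inv_naturality, pre_comp, hk, ← pre_comp, unitors_equal,
      Iso.inv_hom_id, pre_id]
  · rw [← pre_comp, rightUnitor_inv_naturality, pre_comp, hk', ← pre_comp,
      ← pre_whiskerLeft, ← pre_post]
    congr 1
    simp

/-- Both morphisms out of `C ⊗ C` agree along `e` by the unit law of `M`. Both respect the action of
`X`: one by `a_mul`, the other by associativity of `M`. -/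
theorem isMultiplicative_lift {f : HomOver A b X M.X} (hf : IsPointed x M.mon.one f)
    {h : HomOver A b F.C M.X} (he : pre F.e h = post (unit A b) M.mon.one)
    (ha : pre F.a h = post (tensor f h) M.mon.mul) : IsMultiplicative F.mul M.mon.mul h := by
  refine F.homOver_ext hA hf ?_ ?_ ?_
  · rw [← pre_comp, e_mul, pre_post, pre_whiskerRight, he, ← post_whiskerRight, ← post_comp,
      M.mon.one_mul, post_leftUnitor]
  · rw [← pre_comp, a_mul, pre_comp, pre_comp, ha, pre_post, pre_whiskerLeft]
  · rw [pre_post, pre_whiskerRight, ha, ← post_whiskerRight, ← post_comp, M.mon.mul_assoc,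
      post_comp, post_comp, post_associator, ← pre_post, post_whiskerLeft, pre_post]

theorem existsUnique_lift {f : HomOver A b X M.X} (hf : IsPointed x M.mon.one f) :
    ∃! h : HomOver A b F.C M.X, IsMultiplicative F.mul M.mon.mul h ∧
      IsPointed F.e M.mon.one h ∧ pre F.η h = f := by
  obtain ⟨h, he, ha⟩ := F.exists_lift hA hf
  refine ⟨h, ⟨F.isMultiplicative_lift hA hf he ha, he, F.pre_η he ha⟩, ?_⟩
  rintro g ⟨hg, hg', hg''⟩
  -- A multiplicative morphism restricting to `f` along `η` automatically respects the actions, so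
  -- uniqueness for actions applies, again on `C ⊗ 𝟙_`.
  have ha' := F.pre_a_of_isMultiplicative hg
  rw [hg''] at ha'
  have key : pre (ρ_ F.C).hom g = pre (ρ_ F.C).hom h := by
    refine F.homOver_ext hA hf ?_ ?_ ?_
    · rw [← pre_comp, ← pre_comp, rightUnitor_naturality, pre_comp, pre_comp, hg', he]
    · rw [← pre_comp, rightUnitor_naturality, pre_comp, ha', ← pre_whiskerLeft, ← pre_post,
        ← pre_comp, ← rightUnitor_tensor_hom]
    · rw [← pre_comp, rightUnitor_naturality, pre_comp, ha, ← pre_whiskerLeft, ← pre_post,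
        ← pre_comp, ← rightUnitor_tensor_hom]
  have := congrArg (pre (ρ_ F.C).inv) key
  rwa [← pre_comp, ← pre_comp, Iso.inv_hom_id, pre_id, pre_id] at this

end AlgebraicallyFree

end HomOver

/-! ### Isomorphisms of overcategories -/

section Isomorphism

variable {G : Type u₂} [Category.{v₂} G] {X : BasedCategory.{v₃, u₃} G}
  {Y : BasedCategory.{v₄, u₄} G}

theorem basedFunctor_ext {F F' : BasedFunctor X Y} (h : F.toFunctor = F'.toFunctor) : F = F' := by
  obtain ⟨F, hF⟩ := F
  obtain ⟨F', hF'⟩ := F'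
  obtain rfl : F = F' := h
  rfl

/-- The inverse acts on morphisms by the preimage of a conjugate by `eqToHom`. It lies over `G`
because `K` does. -/
theorem isOverisomorphism_of_fullyFaithful (K : BasedFunctor X Y) (hK : K.toFunctor.FullyFaithful)
    (L : Y.obj → X.obj) (hL : ∀ x, L (K.obj x) = x) (hL' : ∀ y, K.obj (L y) = y) :
    IsOverisomorphism K := by
  let M : Y.obj ⥤ X.obj :=
    { obj := L
      map := fun {y y'} f => hK.preimage (eqToHom (hL' y) ≫ f ≫ eqToHom (hL' y').symm)
      map_id := fun y => hK.map_injective (by simp)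
      map_comp := fun f g => hK.map_injective (by simp) }
  have hM : M ⋙ K.toFunctor = 𝟭 Y.obj := CategoryTheory.Functor.ext hL' fun y y' f => by
    simp [M]
  refine ⟨⟨M, ?_⟩, basedFunctor_ext ?_, basedFunctor_ext hM⟩
  · rw [← K.w, ← Functor.assoc, hM, Functor.id_comp]
  · refine CategoryTheory.Functor.ext hL fun x x' f => hK.map_injective ?_
    change K.map (hK.preimage (eqToHom (hL' _) ≫ K.map f ≫ eqToHom (hL' _).symm)) =
      K.map (eqToHom (hL x) ≫ f ≫ eqToHom (hL x').symm)
    simp [eqToHom_map]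

end Isomorphism

/-! ### Monoid structures on retracts of monoids -/

section Retract

variable {V : Type u₁} [Category.{v₁} V] [MonoidalCategory V]

/-- The monoid structure on the image of a split epimorphism of a monoid whose kernel pair is
compatible with the multiplication. -/
@[reducible]
def monObjOfSplitEpi (C : Mon V) {X : V} (x : 𝟙_ V ⟶ X) (s : X ⟶ C.X) (h : C.X ⟶ X)
    (hs : s ≫ h = 𝟙 X) (hx : C.mon.one ≫ h = x)
    (hm : (h ⊗ₘ h) ≫ (s ⊗ₘ s) ≫ C.mon.mul ≫ h = C.mon.mul ≫ h) : MonObj X where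
  one := x
  mul := (s ⊗ₘ s) ≫ C.mon.mul ≫ h
  one_mul := by
    have key : (𝟙_ V) ◁ h ≫ x ▷ X = C.mon.one ▷ C.X ≫ (h ⊗ₘ h) := by
      rw [← hx, MonoidalCategory.tensorHom_def, comp_whiskerRight,
        whisker_exchange_assoc, whisker_exchange]
    have : x ▷ X = (𝟙_ V) ◁ s ≫ C.mon.one ▷ C.X ≫ (h ⊗ₘ h) := by
      rw [← key, ← whiskerLeft_comp_assoc, hs, whiskerLeft_id, Category.id_comp]
    rw [this, Category.assoc, Category.assoc, hm, reassoc_of% C.mon.one_mul,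
      leftUnitor_naturality_assoc, hs, Category.comp_id]
  mul_one := by
    have key : h ▷ (𝟙_ V) ≫ X ◁ x = C.X ◁ C.mon.one ≫ (h ⊗ₘ h) := by
      rw [← hx, MonoidalCategory.tensorHom_def', whiskerLeft_comp,
        ← whisker_exchange_assoc, ← whisker_exchange]
    have : X ◁ x = s ▷ (𝟙_ V) ≫ C.X ◁ C.mon.one ≫ (h ⊗ₘ h) := by
      rw [← key, ← comp_whiskerRight_assoc, hs, id_whiskerRight, Category.id_comp]
    rw [this, Category.assoc, Category.assoc, hm, reassoc_of% C.mon.mul_one,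
      rightUnitor_naturality_assoc, hs, Category.comp_id]
  mul_assoc := by
    have hs' : ((s ⊗ₘ s) ⊗ₘ s) ≫ ((h ⊗ₘ h) ⊗ₘ h) = 𝟙 _ := by
      simp [tensorHom_comp_tensorHom, hs]
    -- The identity factors through `(h ⊗ h) ⊗ h`, so associativity need only be checked after
    -- precomposing with it, where it becomes associativity in `C`.
    rw [← cancel_epi (𝟙 ((X ⊗ X) ⊗ X)), ← hs', Category.assoc, Category.assoc]
    congr 1
    generalize hM : (s ⊗ₘ s) ≫ C.mon.mul ≫ h = M at hm
    calc ((h ⊗ₘ h) ⊗ₘ h) ≫ M ▷ X ≫ M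
        = (((h ⊗ₘ h) ≫ M) ⊗ₘ h) ≫ M := by
          rw [← tensorHom_id, tensorHom_comp_tensorHom_assoc, Category.comp_id]
      _ = C.mon.mul ▷ C.X ≫ C.mon.mul ≫ h := by
          rw [hm, ← hm, ← tensorHom_id, tensorHom_comp_tensorHom_assoc, Category.id_comp, hm]
      _ = (α_ _ _ _).hom ≫ C.X ◁ C.mon.mul ≫ C.mon.mul ≫ h := by
          rw [reassoc_of% C.mon.mul_assoc]
      _ = (α_ _ _ _).hom ≫ (h ⊗ₘ ((h ⊗ₘ h) ≫ M)) ≫ M := by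
          rw [hm, ← hm, ← id_tensorHom, tensorHom_comp_tensorHom_assoc, Category.id_comp, hm]
      _ = ((h ⊗ₘ h) ⊗ₘ h) ≫ (α_ X X X).hom ≫ X ◁ M ≫ M := by
          rw [associator_naturality_assoc, ← id_tensorHom, tensorHom_comp_tensorHom_assoc,
            Category.comp_id]

/-- Replace `h ≫ s` by `t ≫ k` in both factors, move `k` past the multiplication, exchange `k` for
`l` in front of `h`, move `l` back, and cancel `t ≫ l`. For an algebra, `k` is the free functor
applied to the structure map, `l` a counit and `t` a unit. -/
theorem tensorHom_mul_of_fork {C C' : Mon V} {X : V} {s : X ⟶ C.X} {h : C.X ⟶ X} {t : C.X ⟶ C'.X}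
    {k l : C'.X ⟶ C.X} (hk : C'.mon.mul ≫ k = (k ⊗ₘ k) ≫ C.mon.mul)
    (hl : C'.mon.mul ≫ l = (l ⊗ₘ l) ≫ C.mon.mul) (htk : t ≫ k = h ≫ s) (htl : t ≫ l = 𝟙 C.X)
    (hkl : l ≫ h = k ≫ h) :
    (h ⊗ₘ h) ≫ (s ⊗ₘ s) ≫ C.mon.mul ≫ h = C.mon.mul ≫ h := by
  rw [tensorHom_comp_tensorHom_assoc, ← htk, ← tensorHom_comp_tensorHom_assoc, ← reassoc_of% hk,
    ← hkl, reassoc_of% hl, tensorHom_comp_tensorHom_assoc, htl, id_tensorHom_id, Category.id_comp]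

end Retract

/-! ### The left overadjoint -/

section LeftOveradjoint

variable {E : Type u₁} [Category.{v₁} E] {G : Type u₂} [Category.{v₂} G] {A : E ⥤ G}
  [MonoidalOvercategory A]

open HomOver

namespace Overmonoid

theorem hom_ext {C D : Overmonoid A} {f g : C ⟶ D}
    (h : (Overmonoid.Hom.hom f).1 = (Overmonoid.Hom.hom g).1) : f = g := by
  obtain ⟨b, ⟨f, hf⟩, h₁, h₂⟩ := f
  obtain ⟨c, ⟨g, hg⟩, h₁', h₂'⟩ := g
  obtain rfl : f = g := h
  obtain rfl := base_eq_of_isHomLift f hf hg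
  rfl

/-- A morphism of overmonoids over an identity, as a morphism of the fiber. -/
def Hom.fiber {B : G} {M N : Mon (A.Fiber B)} (g : Overmonoid.Hom (A := A) ⟨B, M⟩ ⟨B, N⟩)
    (hg : g.base = 𝟙 B) : M.X ⟶ N.X :=
  ⟨g.hom.1, hg ▸ g.hom.2⟩

theorem Hom.mul_fiber {B : G} {M N : Mon (A.Fiber B)}
    (g : Overmonoid.Hom (A := A) ⟨B, M⟩ ⟨B, N⟩) (hg : g.base = 𝟙 B) :
    M.mon.mul ≫ g.fiber hg = (g.fiber hg ⊗ₘ g.fiber hg) ≫ N.mon.mul := by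
  obtain ⟨b, g, h, h'⟩ := g
  obtain rfl : b = 𝟙 B := hg
  exact Subtype.ext h

end Overmonoid

namespace Pointed

theorem hom_ext {C D : Pointed A} {f g : C ⟶ D}
    (h : (Pointed.Hom.hom f).1 = (Pointed.Hom.hom g).1) : f = g := by
  obtain ⟨b, ⟨f, hf⟩, h₁⟩ := f
  obtain ⟨c, ⟨g, hg⟩, h₁'⟩ := g
  obtain rfl : f = g := h
  obtain rfl := base_eq_of_isHomLift f hf hg
  rfl

/-- A morphism of pointed objects over an identity, as a morphism of the fiber. -/
def Hom.fiber {B : G} {X Y : A.Fiber B} {x : 𝟙_ (A.Fiber B) ⟶ X} {y : 𝟙_ (A.Fiber B) ⟶ Y}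
    (g : Pointed.Hom (A := A) ⟨B, X, x⟩ ⟨B, Y, y⟩) (hg : g.base = 𝟙 B) : X ⟶ Y :=
  ⟨g.hom.1, hg ▸ g.hom.2⟩

theorem Hom.pt_fiber {B : G} {X Y : A.Fiber B} {x : 𝟙_ (A.Fiber B) ⟶ X} {y : 𝟙_ (A.Fiber B) ⟶ Y}
    (g : Pointed.Hom (A := A) ⟨B, X, x⟩ ⟨B, Y, y⟩) (hg : g.base = 𝟙 B) : x ≫ g.fiber hg = y := by
  obtain ⟨b, g, h⟩ := g
  obtain rfl : b = 𝟙 B := hg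
  rw [MonoidalOvercategory.unitHom_id] at h
  exact Subtype.ext (h.trans (Category.id_comp _))

end Pointed

instance : (forgetToPointed A).toFunctor.Faithful where
  map_injective h := Overmonoid.hom_ext
    (congrArg (fun k : Pointed.Hom _ _ => k.hom.1) h)

variable (hA : IsLiberal A)

/-- The algebraically free object on a pointed object. -/
noncomputable def freeOn (X : Pointed A) : AlgebraicallyFree (V := A.Fiber X.base) X.pt :=
  algebraicallyFree (hA.fiber_liberal X.base) X.pt

/-- The free overmonoid on a pointed object. -/
noncomputable def freeOvermonoid (X : Pointed A) : Overmonoid A := ⟨X.base, (freeOn hA X).mon⟩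

/-- The inclusion of a pointed object into its free overmonoid. -/
noncomputable def freeUnit (X : Pointed A) :
    X ⟶ (forgetToPointed A).obj (freeOvermonoid hA X) :=
  { base := 𝟙 X.base
    hom := (freeOn hA X).η
    pt_hom := by
      rw [MonoidalOvercategory.unitHom_id]
      exact (congrArg Subtype.val (freeOn hA X).x_η).trans (Category.id_comp _).symm :
    Pointed.Hom X ⟨X.base, (freeOn hA X).C, (freeOn hA X).e⟩ }

theorem freeUnit_comp_bijective (X : Pointed A) (M : Overmonoid A) :
    Function.Bijective fun g : freeOvermonoid hA X ⟶ M =>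
      freeUnit hA X ≫ (forgetToPointed A).map g := by
  constructor
  · intro g g' h
    have hb : 𝟙 X.base ≫ Overmonoid.Hom.base g = 𝟙 X.base ≫ Overmonoid.Hom.base g' :=
      congrArg Pointed.Hom.base h
    have hv : (freeOn hA X).η.1 ≫ (Overmonoid.Hom.hom g).1 =
        (freeOn hA X).η.1 ≫ (Overmonoid.Hom.hom g').1 :=
      congrArg (fun k : Pointed.Hom _ _ => k.hom.1) h
    obtain ⟨b, g, hm, h₁⟩ := g
    obtain ⟨b', g', hm', h₁'⟩ := g'
    -- The unit lies over an identity, so the two bases agree before the uniqueness over a fixed `b`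
    -- is invoked.
    obtain rfl : b = b' := (Category.id_comp b).symm.trans (hb.trans (Category.id_comp b'))
    have hf : IsPointed X.pt M.mon.mon.one (pre (freeOn hA X).η g) :=
      (pre_comp _ _ _).symm.trans
        ((congrArg (fun u => pre u g) (freeOn hA X).x_η).trans (Subtype.ext h₁))
    exact Overmonoid.hom_ext (congrArg Subtype.val
      (((freeOn hA X).existsUnique_lift hA hf).unique
        ⟨Subtype.ext hm, Subtype.ext h₁, rfl⟩
        ⟨Subtype.ext hm', Subtype.ext h₁', Subtype.ext hv.symm⟩))
  · rintro ⟨b, f, hf⟩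
    obtain ⟨h, ⟨hm, h₁, hη⟩, -⟩ :=
      (freeOn hA X).existsUnique_lift hA (f := f) (M := M.mon) (Subtype.ext hf)
    refine ⟨(⟨b, h, congrArg Subtype.val hm, congrArg Subtype.val h₁⟩ : Overmonoid.Hom _ _), ?_⟩
    exact Pointed.hom_ext (congrArg Subtype.val hη)

/-- The universal property of the free overmonoid. -/
noncomputable def freeEquiv (X : Pointed A) (M : Overmonoid A) :
    (freeOvermonoid hA X ⟶ M) ≃ (X ⟶ (forgetToPointed A).obj M) :=
  Equiv.ofBijective _ (freeUnit_comp_bijective hA X M)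

theorem base_freeEquiv {X : Pointed A} {M : Overmonoid A} (g : freeOvermonoid hA X ⟶ M) :
    Pointed.Hom.base (freeEquiv hA X M g) = Overmonoid.Hom.base g :=
  Category.id_comp _

theorem base_freeEquiv_symm {X : Pointed A} {M : Overmonoid A}
    (f : X ⟶ (forgetToPointed A).obj M) :
    Overmonoid.Hom.base ((freeEquiv hA X M).symm f) = Pointed.Hom.base f := by
  rw [← base_freeEquiv, Equiv.apply_symm_apply]

theorem base_freeEquiv_symm_comp {X Y : Pointed A} (f : X ⟶ Y) :
    Overmonoid.Hom.base ((freeEquiv hA X (freeOvermonoid hA Y)).symm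
      (f ≫ freeEquiv hA Y (freeOvermonoid hA Y) (𝟙 _))) = Pointed.Hom.base f :=
  (base_freeEquiv_symm hA _).trans
    ((congrArg (Pointed.Hom.base f ≫ ·) (base_freeEquiv hA (𝟙 (freeOvermonoid hA Y)))).trans
      (Category.comp_id _))

theorem freeEquiv_comp (X : Pointed A) (M N : Overmonoid A) (g : M ⟶ N)
    (f : freeOvermonoid hA X ⟶ M) :
    freeEquiv hA X N (f ≫ g) = freeEquiv hA X M f ≫ (forgetToPointed A).map g :=
  ((congrArg _ ((forgetToPointed A).map_comp f g)).trans (Category.assoc _ _ _).symm :)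

/-- The free overmonoid overfunctor. -/
noncomputable def free : BasedFunctor (pointed A) (overmonoids A) where
  toFunctor := Adjunction.leftAdjointOfEquiv (G := (forgetToPointed A).toFunctor)
    (freeEquiv hA) (freeEquiv_comp hA)
  w := by
    exact Functor.hext (fun _ => rfl) fun X Y f => heq_of_eq (base_freeEquiv_symm_comp hA f)

theorem isHomLift_id_of_map_eq {C : Type u₁} [Category.{v₁} C] {D : Type u₂} [Category.{v₂} D]
    (p : C ⥤ D) {X Y : C} {B : D} (hX : p.obj X = B) (hY : p.obj Y = B) (f : X ⟶ Y)
    (hf : p.map f = eqToHom (hX.trans hY.symm)) : p.IsHomLift (𝟙 B) f :=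
  IsHomLift.of_fac' _ _ _ hX hY (by simpa using hf)

/-- The adjunction between the free overmonoid functor and the forgetful functor. -/
noncomputable def freeAdjunction : (free hA).toFunctor ⊣ (forgetToPointed A).toFunctor :=
  Adjunction.adjunctionOfEquivLeft (freeEquiv hA) (freeEquiv_comp hA)

theorem freeAdjunction_unit (X : Pointed A) :
    (freeAdjunction hA).unit.app X = freeUnit hA X :=
  (Adjunction.adjunctionOfEquivLeft_unit_app (freeEquiv hA) (freeEquiv_comp hA) X).trans
    (Category.comp_id (freeUnit hA X))

theorem freeAdjunction_counit (M : Overmonoid A) :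
    (freeAdjunction hA).counit.app M =
      (freeEquiv hA ((forgetToPointed A).obj M) M).symm (𝟙 _) :=
  Adjunction.adjunctionOfEquivLeft_counit_app (freeEquiv hA) (freeEquiv_comp hA) M

/-- The free overmonoid overfunctor is left overadjoint to the forgetful overfunctor. -/
noncomputable def freeOveradjunction : Overadjunction (free hA) (forgetToPointed A) where
  adj := freeAdjunction hA
  unit_over X := isHomLift_id_of_map_eq (X := X)
    (Y := (forgetToPointed A).obj (freeOvermonoid hA X)) (pointed A).p rfl rfl
    ((freeAdjunction hA).unit.app X) (congrArg Pointed.Hom.base (freeAdjunction_unit hA X))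
  counit_over M := isHomLift_id_of_map_eq
    (X := freeOvermonoid hA ((forgetToPointed A).obj M)) (Y := M) (overmonoids A).p rfl rfl
    ((freeAdjunction hA).counit.app M)
    ((congrArg Overmonoid.Hom.base (freeAdjunction_counit hA M)).trans
      (base_freeEquiv_symm hA (𝟙 _)))

end LeftOveradjoint

/-! ### Overmonadicity -/

section Overmonadic

variable {E : Type u₁} [Category.{v₁} E] {G : Type u₂} [Category.{v₂} G] {A : E ⥤ G}
  [MonoidalOvercategory A] (hA : IsLiberal A)

open HomOver

theorem base_free_map {X Y : Pointed A} (f : X ⟶ Y) :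
    Overmonoid.Hom.base ((free hA).map f) = Pointed.Hom.base f :=
  base_freeEquiv_symm_comp hA f

theorem base_counit (M : Overmonoid A) :
    Overmonoid.Hom.base ((freeAdjunction hA).counit.app M) = 𝟙 M.base :=
  (congrArg Overmonoid.Hom.base (freeAdjunction_counit hA M)).trans (base_freeEquiv_symm hA (𝟙 _))

theorem freeUnit_comp_map {X Y : Pointed A} (f : X ⟶ Y) :
    freeUnit hA X ≫ (forgetToPointed A).map ((free hA).map f) = f ≫ freeUnit hA Y := by
  rw [← freeAdjunction_unit, ← freeAdjunction_unit]
  exact ((freeAdjunction hA).unit.naturality f).symm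

theorem freeUnit_comp_counit (M : Overmonoid A) :
    freeUnit hA ((forgetToPointed A).obj M) ≫
      (forgetToPointed A).map ((freeAdjunction hA).counit.app M) = 𝟙 _ :=
  (congrArg (· ≫ _) (freeAdjunction_unit hA _)).symm.trans
    ((freeAdjunction hA).right_triangle_components M)

/-- An overmonoid morphism out of a free overmonoid is determined by its restriction along the unit.
This recognizes the counit at an overmonoid built from an algebra. -/
theorem counit_eq_of_freeUnit_comp {M : Overmonoid A}
    (f : freeOvermonoid hA ((forgetToPointed A).obj M) ⟶ M)
    (hf : freeUnit hA _ ≫ (forgetToPointed A).map f = 𝟙 _) :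
    (freeAdjunction hA).counit.app M = f := by
  rw [freeAdjunction_counit]
  exact (Equiv.symm_apply_eq _).2 hf.symm

/-- The counit of the free overmonoid adjunction, in a fiber. -/
noncomputable def counitFiber (M : Overmonoid A) :
    (freeOvermonoid hA ((forgetToPointed A).obj M)).mon.X ⟶ M.mon.X :=
  Overmonoid.Hom.fiber (M := (freeOvermonoid hA ((forgetToPointed A).obj M)).mon) (N := M.mon)
    ((freeAdjunction hA).counit.app M) (base_counit hA M)

theorem mul_counitFiber (M : Overmonoid A) :
    (freeOvermonoid hA ((forgetToPointed A).obj M)).mon.mon.mul ≫ counitFiber hA M =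
      (counitFiber hA M ⊗ₘ counitFiber hA M) ≫ M.mon.mon.mul :=
  Overmonoid.Hom.mul_fiber (M := (freeOvermonoid hA ((forgetToPointed A).obj M)).mon) (N := M.mon)
    ((freeAdjunction hA).counit.app M) (base_counit hA M)

theorem η_counitFiber (M : Overmonoid A) :
    (freeOn hA ((forgetToPointed A).obj M)).η ≫ counitFiber hA M = 𝟙 M.mon.X :=
  Subtype.ext (congrArg (fun k : Pointed.Hom _ _ => k.hom.1) (freeUnit_comp_counit hA M))

/-! ### From algebras to overmonoids -/

section Algebra

variable (a : (freeAdjunction hA).toMonad.Algebra)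

theorem freeUnit_comp_algebra : freeUnit hA a.A ≫ a.a = 𝟙 a.A :=
  (congrArg (· ≫ _) (freeAdjunction_unit hA _)).symm.trans a.unit

theorem base_algebra : Pointed.Hom.base a.a = 𝟙 (Pointed.base a.A) :=
  (Category.id_comp (Pointed.Hom.base a.a)).symm.trans
    (congrArg Pointed.Hom.base (freeUnit_comp_algebra hA a))

/-- The structure morphism of an algebra, in a fiber. -/
noncomputable def algebraFiber : (freeOvermonoid hA a.A).mon.X ⟶ Pointed.X a.A :=
  Pointed.Hom.fiber (x := (freeOvermonoid hA a.A).mon.mon.one) (y := Pointed.pt a.A) a.a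
    (base_algebra hA a)

theorem one_algebraFiber :
    (freeOvermonoid hA a.A).mon.mon.one ≫ algebraFiber hA a = Pointed.pt a.A :=
  Pointed.Hom.pt_fiber (x := (freeOvermonoid hA a.A).mon.mon.one) (y := Pointed.pt a.A) a.a
    (base_algebra hA a)

theorem η_algebraFiber : (freeOn hA a.A).η ≫ algebraFiber hA a = 𝟙 (Pointed.X a.A) :=
  Subtype.ext (congrArg (fun k : Pointed.Hom _ _ => k.hom.1) (freeUnit_comp_algebra hA a))

theorem base_free_map_algebra : Overmonoid.Hom.base ((free hA).map a.a) = 𝟙 (Pointed.base a.A) :=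
  (base_free_map hA a.a).trans (base_algebra hA a)

/-- The image of the structure morphism of an algebra under the free functor, in a fiber. -/
noncomputable def freeAlgebraFiber :
    (freeOvermonoid hA ((forgetToPointed A).obj (freeOvermonoid hA a.A))).mon.X ⟶
      (freeOvermonoid hA a.A).mon.X :=
  Overmonoid.Hom.fiber
    (M := (freeOvermonoid hA ((forgetToPointed A).obj (freeOvermonoid hA a.A))).mon)
    (N := (freeOvermonoid hA a.A).mon) ((free hA).map a.a) (base_free_map_algebra hA a)

theorem mul_algebraFiber :
    (algebraFiber hA a ⊗ₘ algebraFiber hA a) ≫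
        ((freeOn hA a.A).η ⊗ₘ (freeOn hA a.A).η) ≫
          (freeOvermonoid hA a.A).mon.mon.mul ≫ algebraFiber hA a =
      (freeOvermonoid hA a.A).mon.mon.mul ≫ algebraFiber hA a :=
  tensorHom_mul_of_fork (C := (freeOvermonoid hA a.A).mon)
    (C' := (freeOvermonoid hA ((forgetToPointed A).obj (freeOvermonoid hA a.A))).mon)
    (t := (freeOn hA ((forgetToPointed A).obj (freeOvermonoid hA a.A))).η)
    (k := freeAlgebraFiber hA a) (l := counitFiber hA (freeOvermonoid hA a.A))
    (Overmonoid.Hom.mul_fiber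
      (M := (freeOvermonoid hA ((forgetToPointed A).obj (freeOvermonoid hA a.A))).mon)
      (N := (freeOvermonoid hA a.A).mon) ((free hA).map a.a) (base_free_map_algebra hA a))
    (mul_counitFiber hA _)
    (Subtype.ext (congrArg (fun k : Pointed.Hom _ _ => k.hom.1) (freeUnit_comp_map hA a.a)))
    (η_counitFiber hA _)
    (Subtype.ext (congrArg (fun k : Pointed.Hom _ _ => k.hom.1) a.assoc))

/-- The overmonoid corresponding to an algebra. -/
noncomputable def overmonoidOfAlgebra : Overmonoid A where
  base := Pointed.base a.A
  mon :=
    { X := Pointed.X a.A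
      mon := monObjOfSplitEpi (freeOvermonoid hA a.A).mon (Pointed.pt a.A) (freeOn hA a.A).η
        (algebraFiber hA a) (η_algebraFiber hA a) (one_algebraFiber hA a) (mul_algebraFiber hA a) }

/-- The structure map of an algebra lies over an identity only propositionally; this passes from the
fiber equation back to the equation over `b`. -/
theorem mul_hom_of_fiber {B : G} {b : B ⟶ B} (hb : b = 𝟙 B) {M N : Mon (A.Fiber B)}
    (g : HomOver A b M.X N.X) (g' : M.X ⟶ N.X) (hg : g'.1 = g.1)
    (h : (g' ⊗ₘ g') ≫ N.mon.mul = M.mon.mul ≫ g') :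
    M.mon.mul.1 ≫ g.1 = (MonoidalOvercategory.tensorHom g g).1 ≫ N.mon.mul.1 := by
  subst hb
  obtain rfl : g' = g := Subtype.ext hg
  exact (congrArg Subtype.val h).symm

/-- The structure morphism of an algebra, as a morphism of overmonoids. -/
noncomputable def overmonoidHomOfAlgebra : freeOvermonoid hA a.A ⟶ overmonoidOfAlgebra hA a :=
  let h : Pointed.Hom ((forgetToPointed A).obj (freeOvermonoid hA a.A)) a.A := a.a
  { base := h.base
    hom := h.hom
    mul_hom := mul_hom_of_fiber (base_algebra hA a) (M := (freeOvermonoid hA a.A).mon)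
      (N := (overmonoidOfAlgebra hA a).mon) _ (algebraFiber hA a) rfl (mul_algebraFiber hA a)
    one_hom := h.pt_hom :
    Overmonoid.Hom (freeOvermonoid hA a.A) (overmonoidOfAlgebra hA a) }

theorem counit_overmonoidOfAlgebra :
    (freeAdjunction hA).counit.app (overmonoidOfAlgebra hA a) = overmonoidHomOfAlgebra hA a :=
  counit_eq_of_freeUnit_comp hA (M := overmonoidOfAlgebra hA a) _ (freeUnit_comp_algebra hA a)

theorem comparison_overmonoidOfAlgebra :
    (Monad.comparison (freeAdjunction hA)).obj (overmonoidOfAlgebra hA a) = a := by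
  have ext : ∀ (c d : (freeAdjunction hA).toMonad.Algebra), c.A = d.A → HEq c.a d.a → c = d := by
    rintro ⟨_, _, _, _⟩ ⟨_, _, _, _⟩ h h'
    cases h
    cases h'
    rfl
  refine ext _ _ rfl (heq_of_eq ?_)
  exact congrArg (forgetToPointed A).map (counit_overmonoidOfAlgebra hA a)

end Algebra

/-- The counit is multiplicative and `η` is a section of it. Hence the multiplication built from the
comparison algebra of `M` is the original one. -/
theorem mul_eq_of_counit (M : Overmonoid A) :
    ((freeOn hA ((forgetToPointed A).obj M)).η ⊗ₘ (freeOn hA ((forgetToPointed A).obj M)).η) ≫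
        (freeOvermonoid hA ((forgetToPointed A).obj M)).mon.mon.mul ≫ counitFiber hA M =
      M.mon.mon.mul := by
  refine (congrArg (_ ≫ ·) (mul_counitFiber hA M)).trans
    ((tensorHom_comp_tensorHom_assoc _ _ _ _ _).trans ?_)
  exact (congrArg (fun u => (u ⊗ₘ u) ≫ M.mon.mon.mul) (η_counitFiber hA M)).trans
    ((congrArg (· ≫ _) (id_tensorHom_id M.mon.X M.mon.X)).trans (Category.id_comp _))

theorem overmonoid_ext {B : G} {X : A.Fiber B} {m m' : MonObj X} (h₁ : m.one = m'.one)
    (h : m.mul = m'.mul) : (⟨B, @Mon.mk _ _ _ X m⟩ : Overmonoid A) = ⟨B, @Mon.mk _ _ _ X m'⟩ := by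
  obtain ⟨_, _, _, _, _⟩ := m
  obtain ⟨_, _, _, _, _⟩ := m'
  cases h₁
  cases h
  rfl

theorem overmonoidOfAlgebra_comparison (M : Overmonoid A) :
    overmonoidOfAlgebra hA ((Monad.comparison (freeAdjunction hA)).obj M) = M :=
  overmonoid_ext rfl (mul_eq_of_counit hA M)

/-- A pointed morphism out of an overmonoid is multiplicative if its composite with a split
epimorphism of overmonoids is. -/
theorem mul_hom_of_comp {B B' : G} {P M : Mon (A.Fiber B)} {N : Mon (A.Fiber B')} {b : B ⟶ B'}
    (s : M.X ⟶ P.X) (p : P.X ⟶ M.X) (hs : s ≫ p = 𝟙 _)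
    (hp : P.mon.mul ≫ p = (p ⊗ₘ p) ≫ M.mon.mul) (f : HomOver A b M.X N.X)
    (hf : IsMultiplicative P.mon.mul N.mon.mul (pre p f)) :
    IsMultiplicative M.mon.mul N.mon.mul f := by
  have h : pre (p ⊗ₘ p) (pre M.mon.mul f) = pre (p ⊗ₘ p) (post (tensor f f) N.mon.mul) := by
    rw [← pre_comp, ← hp, pre_comp, hf, pre_post, pre_tensorHom]
  have h' := congrArg (pre (s ⊗ₘ s)) h
  rwa [← pre_comp, ← pre_comp _ _ (post _ _), tensorHom_comp_tensorHom, hs, id_tensorHom_id, pre_id,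
    pre_id] at h'

/-- The algebra-morphism equation says that the counit at `M` followed by `f.f` underlies an
overmonoid morphism. The counit is a split epimorphism in the fiber, so `f.f` is itself
multiplicative. -/
theorem comparison_full : (Monad.comparison (freeAdjunction hA)).Full where
  map_surjective {M N} f := by
    let g : freeOvermonoid hA ((forgetToPointed A).obj M) ⟶ N :=
      (free hA).map f.f ≫ (freeAdjunction hA).counit.app N
    have hg : (forgetToPointed A).map g =
        (forgetToPointed A).map ((freeAdjunction hA).counit.app M) ≫ f.f :=
      ((forgetToPointed A).map_comp _ _).trans f.h
    have hgb : Overmonoid.Hom.base g = Pointed.Hom.base f.f :=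
      (congrArg Pointed.Hom.base hg).trans
        ((congrArg (· ≫ Pointed.Hom.base f.f) (base_counit hA M)).trans (Category.id_comp _))
    have hgv : (Overmonoid.Hom.hom g).1 = (counitFiber hA M).1 ≫ (Pointed.Hom.hom f.f).1 :=
      congrArg (fun k : Pointed.Hom _ _ => k.hom.1) hg
    have hm : IsMultiplicative (freeOvermonoid hA ((forgetToPointed A).obj M)).mon.mon.mul
        N.mon.mon.mul (pre (counitFiber hA M) (Pointed.Hom.hom f.f)) := by
      refine Subtype.ext ?_
      refine (congrArg (_ ≫ ·) hgv.symm).trans ((Overmonoid.Hom.mul_hom g).trans ?_)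
      exact congrArg (· ≫ N.mon.mon.mul.1)
        (MonoidalOvercategory.tensorHom_val_congr hgb _ _ _ _ hgv hgv)
    have hm' := mul_hom_of_comp (P := (freeOvermonoid hA ((forgetToPointed A).obj M)).mon)
      (M := M.mon) (N := N.mon) _ (counitFiber hA M) (η_counitFiber hA M) (mul_counitFiber hA M)
      (Pointed.Hom.hom f.f) hm
    exact ⟨({ base := Pointed.Hom.base f.f
              hom := Pointed.Hom.hom f.f
              mul_hom := congrArg Subtype.val hm'
              one_hom := Pointed.Hom.pt_hom f.f } : Overmonoid.Hom M N), rfl⟩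

theorem isOverisomorphism_comparison : IsOverisomorphism (freeOveradjunction hA).comparison :=
  haveI : (Monad.comparison (freeAdjunction hA)).Full := comparison_full hA
  isOverisomorphism_of_fullyFaithful _
    (Functor.FullyFaithful.ofFullyFaithful (Monad.comparison (freeAdjunction hA)))
    (overmonoidOfAlgebra hA) (overmonoidOfAlgebra_comparison hA)
    (comparison_overmonoidOfAlgebra hA)

end Overmonadic

end Overcat

theorem mainTheorem6 {E : Type u₁} [Category.{v₁} E] {G : Type u₂} [Category.{v₂} G]
    (A : E ⥤ G) [Overcat.MonoidalOvercategory A] (hA : Overcat.IsLiberal A) :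
    Overcat.HasLeftOveradjoint (Overcat.forgetToPointed A) ∧
      Overcat.IsOvermonadic (Overcat.forgetToPointed A) :=
  ⟨⟨Overcat.free hA, ⟨Overcat.freeOveradjunction hA⟩⟩,
    Overcat.free hA, Overcat.freeOveradjunction hA, Overcat.isOverisomorphism_comparison hA⟩
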